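/- Let $N$ be a connected nilpotent (real, finite-dimensional) Lie group with Lie algebra $\mathfrak n$, let $\Gamma\subset N$ be a discrete subgroup such that $M=N/\Gamma$ is compact, and let $L$ be an automorphism of the Lie group $N$ with $L(\Gamma)=\Gamma$; write $L$ also for the induced diffeomorphism $x\Gamma\mapsto L(x)\Gamma$ of $M$. Suppose that $L$ is an Anosov automorphism, i.e. $D_eL\colon\mathfrak n\to\mathfrak n$ has no complex eigenvalue of modulus one, and that $L$ has simple spectrum, i.e. the moduli of the complex eigenvalues of $D_eL$, counted with multiplicity, are pairwise distinct. Let $Z$ be the center of $N$, let $\mathfrak z\subseteq\mathfrak n$ be its Lie algebra, and let $V\subset\mathfrak z$ be the $\mathbb Q$-span of $\{X\in\mathfrak z:\exp X\in\Gamma\}$ (the $\mathbb Q$-structure on $\mathfrak z$ given by $\Gamma$). If $L|_Z$ is reducible over $\mathbb Q$, i.e. there is a $\mathbb Q$-subspace $0\ne W\subsetneq V$ with $D_eL(W)\subseteq W$, then $L$ is not locally periodic data rigid. Here a map of $M$ is $C^{1+}$ if it is $C^1$ and its derivative is $\theta$-Hölder for some $\theta>0$, and $\operatorname{Diff}^{1+}(M)$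 is the set of $C^{1+}$ diffeomorphisms of $M$. A diffeomorphism $f$ of $M$ is locally periodic data rigid if there is a $C^1$-neighborhood $\mathcal U$ of $f$ in $\operatorname{Diff}^{1+}(M)$ such that for every $g\in\mathcal U$ and every homeomorphism $h$ of $M$ with $f=h\circ g\circ h^{-1}$: if for every $n\ge 1$ and every $p\in M$ with $g^n(p)=p$ the linear maps $D_pg^n$ and $D_{h(p)}f^n$ are conjugate, then $h$ is $C^{1+}$. -/

import Mathlib

open Set Filter Topology Function
open scoped Manifold ContDiff NNReal

noncomputable section

/-! ## Periodic data rigidity on a manifold -/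

section Manifold

variable {E : Type*} [NormedAddCommGroup E] [NormedSpace ℝ E]
  {M : Type*} [TopologicalSpace M] [ChartedSpace E M]

/-- A self-map of a manifold is `C^{1+}` if it is `C^1` and its derivative is (locally, in charts)
`θ`-Hölder continuous for some `θ > 0`. On a compact manifold local and global Hölder continuity
are the same. -/
def IsC1Plus (f : M → M) : Prop :=
  ContMDiff 𝓘(ℝ, E) 𝓘(ℝ, E) 1 f ∧
    ∃ θ : ℝ≥0, 0 < θ ∧ ∀ x : M, ∃ C : ℝ≥0, ∃ s ∈ 𝓝 (extChartAt 𝓘(ℝ, E) x x),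
      HolderOnWith C θ (fderiv ℝ (writtenInExtChartAt 𝓘(ℝ, E) 𝓘(ℝ, E) x f)) s

/-- The `C^1` topology on the `C^1` diffeomorphisms of `M`: the topology induced by sending `g`
to its tangent map `Tg : TM → TM`, where `C(TM, TM)` carries the compact-open topology. -/
abbrev c1Topology [IsManifold 𝓘(ℝ, E) 1 M] :
    TopologicalSpace (M ≃ₘ^1⟮𝓘(ℝ, E), 𝓘(ℝ, E)⟯ M) :=
  TopologicalSpace.induced
    (fun g ↦ (⟨tangentMap 𝓘(ℝ, E) 𝓘(ℝ, E) g, g.contMDiff.continuous_tangentMap le_rfl⟩ :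
      C(TangentBundle 𝓘(ℝ, E) M, TangentBundle 𝓘(ℝ, E) M)))
    inferInstance

/-- `f` and `g` have the same periodic data with respect to a conjugacy `h` with
`f = h ∘ g ∘ h⁻¹`: whenever `g^n p = p` with `n ≥ 1`, the linear maps `D_p g^n` and
`D_{h p} f^n` are conjugate. (Every tangent space of `M` is modelled on `E`, and `g^n p = p`,
`f^n (h p) = h p`, so that both differentials are endomorphisms of `E`.) -/
def SamePeriodicData (f g h : M → M) : Prop :=
  ∀ (p : M) (n : ℕ), 0 < n → IsPeriodicPt g n p →
    ∃ A : TangentSpace 𝓘(ℝ, E) p ≃L[ℝ] TangentSpace 𝓘(ℝ, E) (h p),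
      ∀ v : E, A (mfderiv 𝓘(ℝ, E) 𝓘(ℝ, E) g^[n] p v) =
        mfderiv 𝓘(ℝ, E) 𝓘(ℝ, E) f^[n] (h p) (A v)

/-- Local periodic data rigidity of a diffeomorphism `f`: for all `C^{1+}` diffeomorphisms `g` in
some `C^1` neighbourhood of `f` and all topological conjugacies `h` between `f` and `g`,
`f = h ∘ g ∘ h⁻¹`, if `f` and `g` have the same periodic data with respect to `h` then `h` is
`C^{1+}`. -/
def LocallyPeriodicDataRigid [IsManifold 𝓘(ℝ, E) 1 M]
    (f : M ≃ₘ^1⟮𝓘(ℝ, E), 𝓘(ℝ, E)⟯ M) : Prop :=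
  ∃ U ∈ @nhds _ (c1Topology (E := E) (M := M)) f, ∀ g ∈ U, IsC1Plus (E := E) g →
    ∀ h : M ≃ₜ M, (∀ x, f (h x) = h (g x)) → SamePeriodicData (E := E) f g h →
      IsC1Plus (E := E) h

end Manifold

/-! ## The manifold `N ⧸ Γ` of cosets `x Γ` -/

section Quotient

theorem isLocalHomeomorph_quotientMk (E : Type*) [NormedAddCommGroup E] [NormedSpace ℝ E]
    {N : Type*} [TopologicalSpace N] [ChartedSpace E N] [Group N] [LieGroup 𝓘(ℝ, E) ∞ N]
    (Γ : Subgroup N) [DiscreteTopology Γ] :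
    IsLocalHomeomorph (QuotientGroup.mk : N → N ⧸ Γ) := by
  have : IsTopologicalGroup N := topologicalGroup_of_lieGroup 𝓘(ℝ, E) ∞
  exact (Γ.isQuotientCoveringMap ⟨inferInstance⟩).isCoveringMap.isLocalHomeomorph

variable {E : Type*} [NormedAddCommGroup E] [NormedSpace ℝ E]
  {N : Type*} [TopologicalSpace N] [ChartedSpace E N] [Group N]
  [LieGroup 𝓘(ℝ, E) ∞ N] (Γ : Subgroup N) [DiscreteTopology Γ]

/-- The charts of `N ⧸ Γ` are local inverses of the projection `N → N ⧸ Γ` followed by charts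
of `N`. -/
instance quotientChartedSpace : ChartedSpace E (N ⧸ Γ) :=
  (isLocalHomeomorph_quotientMk E Γ).chartedSpace QuotientGroup.mk_surjective

/-- A lift of a point of `N ⧸ Γ` (the one used for the chart at that point). -/
def quotientLift (q : N ⧸ Γ) : N :=
  (QuotientGroup.mk_surjective (s := Γ)).hasRightInverse.choose q

/-- The local inverse of the projection used for the chart at `q`. -/
def quotientSection (q : N ⧸ Γ) : OpenPartialHomeomorph (N ⧸ Γ) N :=
  (isLocalHomeomorph_quotientMk E Γ).localInverseAt (quotientLift Γ q)

/-- Where the local inverse composed with the projection is defined it is locally a right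
translation by an element of `Γ`. -/
lemma quotientSection_mk_eventuallyEq (q : N ⧸ Γ) (x : N)
    (hx : (x : N ⧸ Γ) ∈ (quotientSection (E := E) Γ q).source) :
    ∃ γ : N, (fun y : N ↦ quotientSection (E := E) Γ q (y : N ⧸ Γ)) =ᶠ[𝓝 x] fun y ↦ y * γ := by
  have hl := isLocalHomeomorph_quotientMk E Γ
  set s := quotientSection (E := E) Γ q with hs
  have : IsTopologicalGroup N := topologicalGroup_of_lieGroup 𝓘(ℝ, E) ∞
  have hmk : ∀ z ∈ s.source, ((s z : N) : N ⧸ Γ) = z := fun z hz ↦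
    hl.apply_localInverseAt_of_mem hz
  have hγ : x⁻¹ * s x ∈ Γ := QuotientGroup.eq.1 (hmk _ hx).symm
  refine ⟨x⁻¹ * s x, ?_⟩
  have h1 : ∀ᶠ y : N in 𝓝 x, (y : N ⧸ Γ) ∈ s.source :=
    hl.continuous.continuousAt (s.open_source.mem_nhds hx)
  have h2 : ∀ᶠ y : N in 𝓝 x, y * (x⁻¹ * s x) ∈ s.target := by
    have hc : ContinuousAt (fun y : N ↦ y * (x⁻¹ * s x)) x := by fun_prop
    refine hc (s.open_target.mem_nhds ?_)
    simpa using s.map_source hx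
  filter_upwards [h1, h2] with y hy1 hy2
  refine hl.injOn_localInverseAt_target (s.map_source hy1) hy2 ?_
  rw [hmk _ hy1]
  exact (QuotientGroup.mk_mul_of_mem y hγ).symm

lemma quotient_chartAt (q : N ⧸ Γ) :
    chartAt E q = (quotientSection (E := E) Γ q).trans (chartAt E (quotientLift Γ q)) := rfl

instance quotientIsManifold : IsManifold 𝓘(ℝ, E) ∞ (N ⧸ Γ) := by
  have : IsTopologicalGroup N := topologicalGroup_of_lieGroup 𝓘(ℝ, E) ∞
  apply isManifold_of_contDiffOn
  rintro _ _ ⟨q, rfl⟩ ⟨q', rfl⟩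
  change ContDiffOn ℝ ∞ (𝓘(ℝ, E) ∘ (((quotientSection (E := E) Γ q).trans
    (chartAt E (quotientLift Γ q))).symm.trans ((quotientSection (E := E) Γ q').trans
    (chartAt E (quotientLift Γ q')))) ∘ 𝓘(ℝ, E).symm) (𝓘(ℝ, E).symm ⁻¹' (((quotientSection (E := E) Γ q).trans
    (chartAt E (quotientLift Γ q))).symm.trans ((quotientSection (E := E) Γ q').trans
    (chartAt E (quotientLift Γ q')))).source ∩ range 𝓘(ℝ, E))
  set s := quotientSection (E := E) Γ q
  set s' := quotientSection (E := E) Γ q'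
  set c := chartAt E (quotientLift Γ q) with hc
  set c' := chartAt E (quotientLift Γ q') with hc'
  have hsymm : ∀ y, s.symm y = (y : N ⧸ Γ) := fun y ↦
    congrFun ((isLocalHomeomorph_quotientMk E Γ).localInverseAt_symm _) y
  rintro v ⟨hv, -⟩
  simp only [mfld_simps] at hv
  rw [hsymm] at hv
  obtain ⟨γ, hγ⟩ := quotientSection_mk_eventuallyEq Γ q' (c.symm v) hv.2.1
  refine ContDiffAt.contDiffWithinAt ?_
  have key : ContDiffAt ℝ ∞ (fun w ↦ c' (c.symm w * γ)) v := by
    have h1 : ContMDiffAt 𝓘(ℝ, E) 𝓘(ℝ, E) ∞ c.symm v :=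
      (contMDiffOn_chart_symm (n := ∞)).contMDiffAt (c.open_target.mem_nhds hv.1.1)
    have h2 : ContMDiffAt 𝓘(ℝ, E) 𝓘(ℝ, E) ∞ (fun w ↦ c.symm w * γ) v :=
      h1.mul contMDiffAt_const
    have h3 : ContMDiffAt 𝓘(ℝ, E) 𝓘(ℝ, E) ∞ c' (c.symm v * γ) := by
      refine (contMDiffOn_chart (n := ∞)).contMDiffAt (c'.open_source.mem_nhds ?_)
      rw [← hγ.eq_of_nhds]
      exact hv.2.2
    exact (ContMDiffAt.comp v h3 h2).contDiffAt
  refine key.congr_of_eventuallyEq ?_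
  have hcont : ContinuousAt c.symm v := c.symm.continuousAt hv.1.1
  filter_upwards [hcont.eventually hγ] with w hw
  simp only [mfld_simps]
  rw [hsymm, hw]

/-- The local inverses of the projection are smooth. -/
theorem contMDiffAt_quotientSection (q : N ⧸ Γ) :
    ContMDiffAt 𝓘(ℝ, E) 𝓘(ℝ, E) ∞ (quotientSection (E := E) Γ q) q := by
  set s := quotientSection (E := E) Γ q
  set c := chartAt E (quotientLift Γ q) with hc
  have hq : q ∈ (s.trans c).source := mem_chart_source E q
  have h1 : ContMDiffAt 𝓘(ℝ, E) 𝓘(ℝ, E) ∞ (s.trans c) q :=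
    (contMDiffOn_chart (n := ∞) (x := q)).contMDiffAt ((s.trans c).open_source.mem_nhds hq)
  have h2 : ContMDiffAt 𝓘(ℝ, E) 𝓘(ℝ, E) ∞ c.symm (s.trans c q) :=
    (contMDiffOn_chart_symm (n := ∞)).contMDiffAt
      (c.open_target.mem_nhds (c.map_source hq.2))
  refine (h2.comp q h1).congr_of_eventuallyEq ?_
  filter_upwards [(s.trans c).open_source.mem_nhds hq] with z hz
  exact (c.left_inv hz.2).symm

/-- The projection `N → N ⧸ Γ` is smooth. -/
theorem contMDiff_quotientMk :
    ContMDiff 𝓘(ℝ, E) 𝓘(ℝ, E) ∞ (QuotientGroup.mk : N → N ⧸ Γ) := by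
  intro x
  have hl := isLocalHomeomorph_quotientMk E Γ
  set q : N ⧸ Γ := (x : N ⧸ Γ) with hq
  set s := quotientSection (E := E) Γ q with hs
  set c := chartAt E (quotientLift Γ q) with hc
  have hxq : q ∈ (s.trans c).source := mem_chart_source E q
  obtain ⟨γ, hγ⟩ := quotientSection_mk_eventuallyEq (E := E) Γ q x hxq.1
  have h1 : ContMDiffAt 𝓘(ℝ, E) 𝓘(ℝ, E) ∞ (fun y : N ↦ s (y : N ⧸ Γ)) x :=
    ((contMDiffAt_id (I := 𝓘(ℝ, E))).mul contMDiffAt_const).congr_of_eventuallyEq hγ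
  have h2 : ContMDiffAt 𝓘(ℝ, E) 𝓘(ℝ, E) ∞ c (s q) :=
    (contMDiffOn_chart (n := ∞)).contMDiffAt (c.open_source.mem_nhds hxq.2)
  have h3 : ContMDiffAt 𝓘(ℝ, E) 𝓘(ℝ, E) ∞ (s.trans c).symm (c (s q)) :=
    (contMDiffOn_chart_symm (n := ∞) (x := q)).contMDiffAt
      ((s.trans c).open_target.mem_nhds ((s.trans c).map_source hxq))
  refine (h3.comp x (h2.comp x h1)).congr_of_eventuallyEq ?_
  filter_upwards [hl.continuous.continuousAt ((s.trans c).open_source.mem_nhds hxq)] with y hy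
  exact ((s.trans c).left_inv hy).symm

end Quotient

/-! ## Automorphisms of `N` preserving `Γ` -/

section Automorphism

/-- An automorphism of the Lie group `N` that maps `Γ` onto itself. -/
structure LatticeAut (E : Type*) [NormedAddCommGroup E] [NormedSpace ℝ E]
    {N : Type*} [TopologicalSpace N] [ChartedSpace E N] [Group N] (Γ : Subgroup N) where
  toMulEquiv : N ≃* N
  contMDiff_toFun : ContMDiff 𝓘(ℝ, E) 𝓘(ℝ, E) ∞ toMulEquiv
  contMDiff_invFun : ContMDiff 𝓘(ℝ, E) 𝓘(ℝ, E) ∞ toMulEquiv.symm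
  map_eq : Γ.map toMulEquiv.toMonoidHom = Γ

variable {E : Type*} [NormedAddCommGroup E] [NormedSpace ℝ E]
  {N : Type*} [TopologicalSpace N] [ChartedSpace E N] [Group N]
  {Γ : Subgroup N}

namespace LatticeAut

theorem mem_iff (L : LatticeAut E Γ) (x : N) : L.toMulEquiv x ∈ Γ ↔ x ∈ Γ := by
  constructor
  · intro h
    obtain ⟨y, hy, hyx⟩ := (SetLike.ext_iff.1 L.map_eq _).2 h
    have : y = x := L.toMulEquiv.injective hyx
    exact this ▸ hy
  · intro h
    exact (SetLike.ext_iff.1 L.map_eq _).1 ⟨x, h, rfl⟩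

/-- The induced bijection `x Γ ↦ L(x) Γ` of `N ⧸ Γ`. -/
def quotientEquiv (L : LatticeAut E Γ) : (N ⧸ Γ) ≃ (N ⧸ Γ) :=
  Quotient.congr L.toMulEquiv.toEquiv fun a b ↦ by
    change QuotientGroup.leftRel Γ a b ↔
      QuotientGroup.leftRel Γ (L.toMulEquiv a) (L.toMulEquiv b)
    rw [QuotientGroup.leftRel_apply, QuotientGroup.leftRel_apply, ← map_inv, ← map_mul, L.mem_iff]

theorem quotientEquiv_mk (L : LatticeAut E Γ) (x : N) :
    L.quotientEquiv (x : N ⧸ Γ) = ((L.toMulEquiv x : N) : N ⧸ Γ) := rfl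

theorem quotientEquiv_symm_mk (L : LatticeAut E Γ) (x : N) :
    L.quotientEquiv.symm (x : N ⧸ Γ) = ((L.toMulEquiv.symm x : N) : N ⧸ Γ) := rfl

/-- The induced diffeomorphism `x Γ ↦ L(x) Γ` of `N ⧸ Γ`. -/
def quotientDiffeo [LieGroup 𝓘(ℝ, E) ∞ N] [DiscreteTopology Γ] (L : LatticeAut E Γ) :
    (N ⧸ Γ) ≃ₘ^1⟮𝓘(ℝ, E), 𝓘(ℝ, E)⟯ (N ⧸ Γ) where
  toEquiv := L.quotientEquiv
  contMDiff_toFun := by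
    intro q
    have h1 := contMDiffAt_quotientSection (E := E) Γ q
    have h2 : ContMDiffAt 𝓘(ℝ, E) 𝓘(ℝ, E) ∞ (fun x : N ↦ (L.toMulEquiv x : N ⧸ Γ))
        (quotientSection (E := E) Γ q q) :=
      ((contMDiff_quotientMk Γ).comp L.contMDiff_toFun).contMDiffAt
    have hq : q ∈ (quotientSection (E := E) Γ q).source := (mem_chart_source E q).1
    refine ((h2.comp q h1).congr_of_eventuallyEq ?_).of_le (by simp)
    filter_upwards [(quotientSection (E := E) Γ q).open_source.mem_nhds hq] with z hz
    conv_lhs =>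
      rw [← (isLocalHomeomorph_quotientMk E Γ).apply_localInverseAt_of_mem hz]
    rfl
  contMDiff_invFun := by
    intro q
    have h1 := contMDiffAt_quotientSection (E := E) Γ q
    have h2 : ContMDiffAt 𝓘(ℝ, E) 𝓘(ℝ, E) ∞ (fun x : N ↦ (L.toMulEquiv.symm x : N ⧸ Γ))
        (quotientSection (E := E) Γ q q) :=
      ((contMDiff_quotientMk Γ).comp L.contMDiff_invFun).contMDiffAt
    have hq : q ∈ (quotientSection (E := E) Γ q).source := (mem_chart_source E q).1
    refine ((h2.comp q h1).congr_of_eventuallyEq ?_).of_le (by simp)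
    filter_upwards [(quotientSection (E := E) Γ q).open_source.mem_nhds hq] with z hz
    conv_lhs =>
      rw [← (isLocalHomeomorph_quotientMk E Γ).apply_localInverseAt_of_mem hz]
    rfl

instance groupLieAlgebraFinite [FiniteDimensional ℝ E] :
    Module.Finite ℝ (GroupLieAlgebra 𝓘(ℝ, E) N) :=
  inferInstanceAs (Module.Finite ℝ E)

/-- The differential of `L` at the identity, acting on the Lie algebra of `N`. As `L 1 = 1` it is
an endomorphism of the tangent space at `1`. -/
def differential (L : LatticeAut E Γ) :
    GroupLieAlgebra 𝓘(ℝ, E) N →ₗ[ℝ] GroupLieAlgebra 𝓘(ℝ, E) N :=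
  (mfderiv 𝓘(ℝ, E) 𝓘(ℝ, E) L.toMulEquiv 1 : E →L[ℝ] E).toLinearMap

/-- The complex eigenvalues of the differential of `L` at the identity, with multiplicity. -/
def eigenvalues [FiniteDimensional ℝ E] (L : LatticeAut E Γ) : Multiset ℂ :=
  L.differential.charpoly.aroots ℂ

/-- `L` is an Anosov automorphism of `N ⧸ Γ`: its differential at the identity is hyperbolic. -/
def IsAnosov [FiniteDimensional ℝ E] (L : LatticeAut E Γ) : Prop :=
  ∀ z ∈ L.eigenvalues, ‖z‖ ≠ 1

/-- `L` has simple spectrum: the moduli of all the eigenvalues, counted with multiplicity, are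
distinct. -/
def HasSimpleSpectrum [FiniteDimensional ℝ E] (L : LatticeAut E Γ) : Prop :=
  (L.eigenvalues.map (‖·‖)).Nodup

end LatticeAut

/-- `γ` is the one-parameter subgroup `t ↦ exp (t X)` of `N`. -/
def IsOneParameterSubgroup (γ : ℝ → N) (X : GroupLieAlgebra 𝓘(ℝ, E) N) : Prop :=
  ContMDiff 𝓘(ℝ, ℝ) 𝓘(ℝ, E) ∞ γ ∧ (∀ s t, γ (s + t) = γ s * γ t) ∧
    mfderiv 𝓘(ℝ, ℝ) 𝓘(ℝ, E) γ 0 (1 : ℝ) = (show E from X)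

/-- The preimage `exp⁻¹(Γ)` in the Lie algebra of the center `Z` of `N`: the vectors `X` such that
`exp (t X) ∈ Z` for all `t` and `exp X ∈ Γ`. -/
def centralLog (E : Type*) [NormedAddCommGroup E] [NormedSpace ℝ E]
    {N : Type*} [TopologicalSpace N] [ChartedSpace E N] [Group N] (Γ : Subgroup N) :
    Set (GroupLieAlgebra 𝓘(ℝ, E) N) :=
  {X | ∃ γ : ℝ → N, IsOneParameterSubgroup γ X ∧ (∀ t, γ t ∈ Subgroup.center N) ∧ γ 1 ∈ Γ}

/-- The Lie algebra of `N` as a vector space over `ℚ`. -/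
instance groupLieAlgebraRatModule : Module ℚ (GroupLieAlgebra 𝓘(ℝ, E) N) :=
  Module.compHom (GroupLieAlgebra 𝓘(ℝ, E) N) (algebraMap ℚ ℝ)

/-- The `ℚ`-structure given by `Γ` on the Lie algebra of the center of `N`: the `ℚ`-span of
`exp⁻¹(Γ)` in it. -/
def centerRationalStructure (E : Type*) [NormedAddCommGroup E] [NormedSpace ℝ E]
    {N : Type*} [TopologicalSpace N] [ChartedSpace E N] [Group N] (Γ : Subgroup N) :
    Submodule ℚ (GroupLieAlgebra 𝓘(ℝ, E) N) :=
  Submodule.span ℚ (centralLog E Γ)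

/-- The restriction of `L` to the center of `N` is reducible over `ℚ` with respect to the
`ℚ`-structure given by `Γ`: the action of the differential of `L` on the rational vectors of the
Lie algebra of the center has an invariant `ℚ`-subspace that is neither zero nor everything. -/
def LatticeAut.IsReducibleOnCenter (L : LatticeAut E Γ) : Prop :=
  ∃ W : Submodule ℚ (GroupLieAlgebra 𝓘(ℝ, E) N),
    W ≠ ⊥ ∧ W < centerRationalStructure E Γ ∧ ∀ X ∈ W, L.differential X ∈ W

end Automorphism

end

/-!
By reducibility over `ℚ` and semisimplicity of the differential, the span of the rational vectors
of the center splits into two rational invariant subspaces. Each of them contains an expanding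
eigenvector, since the iterates of a nonzero lattice vector cannot tend to zero. So there are a
subspace `S` spanned by central vectors whose exponentials lie in `Γ`, an expanding eigenvector
`v ∈ S` with eigenvalue `c`, and a central eigenvector `w ∉ S` with eigenvalue `d` such that
`1 < |c| < |d|`. As in de la Llave's counterexamples, one perturbs `L` along `v`: for a smooth
function `φ` on `N ⧸ Γ` that is constant on the orbits of `exp S`, consider
`g q = exp (ε φ(q) v) • L q`, which tends to `L` in the `C¹` topology as `ε → 0`.

* `L` is conjugate to `g` by a map `h q = exp (u(q) v) • q`, where `u` is the bounded solution of
  `c u = ε φ + u ∘ L`.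
* At a periodic point the differential of `g ^ n` differs from that of `L ^ n` by an operator
  `ℓ ⊗ v` with `ℓ v = 0`. As the spectrum is simple, this does not change the conjugacy class.
* Choose `φ` to be `1` at `q = exp (t₀ w) Γ` and to vanish at the identity coset, on the backward
  `L`-orbit of `q`, and on a long enough piece of its forward orbit. Then `u(q) ≠ 0` and
  `u(exp (d⁻ᵏ t₀ w) Γ) = c⁻ᵏ u(q)`. As `|c| < |d|`, the function `u` does not decay linearly along
  `w` at the identity coset, so `h` is not differentiable there.
-/

noncomputable section

/-! ## Derivatives between the model spaces -/

section HasModelDeriv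

variable {E : Type*} [NormedAddCommGroup E] [NormedSpace ℝ E]
  {M : Type*} [TopologicalSpace M] [ChartedSpace E M]
  {E' : Type*} [NormedAddCommGroup E'] [NormedSpace ℝ E']
  {M' : Type*} [TopologicalSpace M'] [ChartedSpace E' M']
  {E'' : Type*} [NormedAddCommGroup E''] [NormedSpace ℝ E'']
  {M'' : Type*} [TopologicalSpace M''] [ChartedSpace E'' M'']

/-- `f` has derivative `A` at `x`, the tangent spaces being identified with the model spaces.
Stated with `A` of a non-dependent type, so that derivatives at different points can be compared
and composed. -/
def HasModelDeriv (f : M → M') (x : M) (A : E →L[ℝ] E') : Prop :=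
  HasMFDerivAt 𝓘(ℝ, E) 𝓘(ℝ, E') f x A

/-- The derivative of `f` at `x`, the tangent spaces being identified with the model spaces
(zero if `f` is not differentiable at `x`). -/
def modelDeriv (f : M → M') (x : M) : E →L[ℝ] E' :=
  mfderiv 𝓘(ℝ, E) 𝓘(ℝ, E') f x

theorem hasModelDeriv_of_contMDiffAt {n : ℕ∞ω} {f : M → M'} {x : M}
    (hf : ContMDiffAt 𝓘(ℝ, E) 𝓘(ℝ, E') n f x) (hn : n ≠ 0) :
    HasModelDeriv f x (modelDeriv f x : E →L[ℝ] E') :=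
  (hf.mdifferentiableAt hn).hasMFDerivAt

theorem hasModelDeriv_id (x : M) : HasModelDeriv (fun y : M ↦ y) x (ContinuousLinearMap.id ℝ E) :=
  hasMFDerivAt_id x

theorem hasModelDeriv_iff_hasFDerivAt {f : E → E'} {x : E} {A : E →L[ℝ] E'} :
    HasModelDeriv f x A ↔ HasFDerivAt f A x :=
  hasMFDerivAt_iff_hasFDerivAt

namespace HasModelDeriv

variable {f : M → M'} {x : M} {A : E →L[ℝ] E'}

theorem continuousAt (hf : HasModelDeriv f x A) : ContinuousAt f x :=
  HasMFDerivAt.continuousAt hf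

theorem comp {g : M' → M''} {y : M'} {B : E' →L[ℝ] E''}
    (hg : HasModelDeriv g y B) (hf : HasModelDeriv f x A) (hy : f x = y) :
    HasModelDeriv (fun z ↦ g (f z)) x (B.comp A) := by
  subst hy
  exact HasMFDerivAt.comp (I' := 𝓘(ℝ, E')) (E' := E') x hg hf

theorem unique {B : E →L[ℝ] E'} (hA : HasModelDeriv f x A) (hB : HasModelDeriv f x B) : A = B :=
  hasMFDerivAt_unique hA hB

theorem modelDeriv_eq (hA : HasModelDeriv f x A) : modelDeriv f x = A :=
  HasMFDerivAt.mfderiv hA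

theorem congr {g : M → M'} (hA : HasModelDeriv f x A) (h : g =ᶠ[𝓝 x] f) : HasModelDeriv g x A :=
  HasMFDerivAt.congr_of_eventuallyEq hA h

theorem injective_of_leftInverse (hf : HasModelDeriv f x A) {g : M' → M} {B : E' →L[ℝ] E}
    (hg : HasModelDeriv g (f x) B) (hgf : ∀ᶠ y in 𝓝 x, g (f y) = y) : Injective A := by
  have hBA : B.comp A = ContinuousLinearMap.id ℝ E :=
    (hg.comp hf rfl).unique ((hasModelDeriv_id x).congr hgf)
  exact LeftInverse.injective (g := B) fun v ↦ congrArg (fun C : E →L[ℝ] E ↦ C v) hBA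

theorem mul_of_eq_one {N : Type*} [TopologicalSpace N] [ChartedSpace E' N] [Group N]
    [LieGroup 𝓘(ℝ, E') ∞ N] {f g : M → N} {B : E →L[ℝ] E'}
    (hf : HasModelDeriv f x A) (hg : HasModelDeriv g x B) (hfx : f x = 1) (hgx : g x = 1) :
    HasModelDeriv (fun y ↦ f y * g y) x (A + B) := by
  have hmul : MDifferentiableAt (𝓘(ℝ, E').prod 𝓘(ℝ, E')) 𝓘(ℝ, E') (fun p : N × N ↦ p.1 * p.2)
      ((1 : N), (1 : N)) := (contMDiff_mul 𝓘(ℝ, E') ∞).mdifferentiableAt (by simp)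
  have hleft : modelDeriv (fun z : N ↦ z * 1) 1 = ContinuousLinearMap.id ℝ E' := by
    simpa only [mul_one] using (hasModelDeriv_id (1 : N)).modelDeriv_eq
  have hright : modelDeriv (fun z : N ↦ 1 * z) 1 = ContinuousLinearMap.id ℝ E' := by
    simpa only [one_mul] using (hasModelDeriv_id (1 : N)).modelDeriv_eq
  have hderiv : (mfderiv (𝓘(ℝ, E').prod 𝓘(ℝ, E')) 𝓘(ℝ, E') (fun p : N × N ↦ p.1 * p.2)
      ((1 : N), (1 : N)) : E' × E' →L[ℝ] E') =
      ContinuousLinearMap.fst ℝ E' E' + ContinuousLinearMap.snd ℝ E' E' := by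
    refine ContinuousLinearMap.ext fun v ↦ (mfderiv_prod_eq_add_apply (v := v) hmul).trans ?_
    exact congrArg₂ (fun (C D : E' →L[ℝ] E') ↦ C v.1 + D v.2) hleft hright
  have hmul' : HasMFDerivAt (𝓘(ℝ, E').prod 𝓘(ℝ, E')) 𝓘(ℝ, E') (fun p : N × N ↦ p.1 * p.2)
      (f x, g x)
      (ContinuousLinearMap.fst ℝ E' E' + ContinuousLinearMap.snd ℝ E' E' : E' × E' →L[ℝ] E') := by
    rw [hfx, hgx, ← hderiv]
    exact hmul.hasMFDerivAt
  exact HasMFDerivAt.comp x hmul' (hf.prodMk hg)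

theorem hasFDerivAt_chartAt {f : E' → M} {x : E'} {A : E' →L[ℝ] E} (hf : HasModelDeriv f x A) :
    HasFDerivAt (fun y ↦ chartAt E (f x) (f y)) A x := by
  have := hf.2
  simp only [writtenInExtChartAt, extChartAt, mfld_simps] at this
  exact hasFDerivWithinAt_univ.1 this

theorem isBigO_sub_rev [FiniteDimensional ℝ E'] {f : E' → M} {x : E'} {A : E' →L[ℝ] E}
    (hf : HasModelDeriv f x A) (hA : Injective A) :
    (fun y ↦ y - x) =O[𝓝 x] fun y ↦ chartAt E (f x) (f y) - chartAt E (f x) (f x) := by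
  obtain ⟨K, -, hK⟩ := (LinearMap.injective_iff_antilipschitz (A : E' →ₗ[ℝ] E)).1 hA
  have hAO : (fun y ↦ y - x) =O[𝓝 x] fun y ↦ A (y - x) := by
    refine Asymptotics.IsBigO.of_bound K (Eventually.of_forall fun y ↦ ?_)
    simpa using hK.le_mul_dist (y - x) 0
  refine hAO.trans ((hf.hasFDerivAt_chartAt.isLittleO.trans_isBigO hAO).right_isBigO_add.congr_right
    fun y ↦ ?_)
  simp

end HasModelDeriv

theorem isLocallyConstant_of_hasModelDeriv_zero [IsManifold 𝓘(ℝ, E) 1 M] {f : E' → M}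
    (hf : ∀ x, HasModelDeriv f x (0 : E' →L[ℝ] E)) : IsLocallyConstant f := by
  refine (IsLocallyConstant.iff_eventually_eq f).2 fun x ↦ ?_
  set χ := chartAt E (f x)
  obtain ⟨r, hr, hball⟩ := Metric.eventually_nhds_iff_ball.1 <|
    (hf x).continuousAt.eventually (χ.open_source.mem_nhds (mem_chart_source E (f x)))
  have hderiv : ∀ y ∈ Metric.ball x r, HasFDerivAt (χ ∘ f) (0 : E' →L[ℝ] E) y := by
    intro y hy
    have hχ : ContMDiffAt 𝓘(ℝ, E) 𝓘(ℝ, E) 1 χ (f y) :=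
      contMDiffOn_chart.contMDiffAt (χ.open_source.mem_nhds (hball y hy))
    have := (hasModelDeriv_of_contMDiffAt hχ one_ne_zero).comp (hf y) rfl
    rwa [ContinuousLinearMap.comp_zero, hasModelDeriv_iff_hasFDerivAt] at this
  filter_upwards [Metric.ball_mem_nhds x hr] with y hy
  have hx := Metric.mem_ball_self (x := x) hr
  refine χ.injOn (hball y hy) (hball x hx) ?_
  exact Metric.isOpen_ball.is_const_of_fderiv_eq_zero (convex_ball x r).isPreconnected
    (fun z hz ↦ (hderiv z hz).differentiableAt.differentiableWithinAt)
    (fun z hz ↦ (hderiv z hz).fderiv) hy hx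

end HasModelDeriv

/-! ## The exponential map of the center -/

section CentralExp

variable {E : Type*} [NormedAddCommGroup E] [NormedSpace ℝ E]
  {N : Type*} [TopologicalSpace N] [ChartedSpace E N] [Group N]

/-- `γ` is a smooth one-parameter subgroup of the center of `N` with velocity `X`. -/
structure IsCentralFlow (γ : ℝ → N) (X : E) : Prop where
  contMDiff : ContMDiff 𝓘(ℝ, ℝ) 𝓘(ℝ, E) ∞ γ
  map_add : ∀ s t, γ (s + t) = γ s * γ t
  hasModelDeriv : HasModelDeriv γ 0 (ContinuousLinearMap.toSpanSingleton ℝ X)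
  mem_center : ∀ t, γ t ∈ Subgroup.center N

theorem isCentralFlow_iff {γ : ℝ → N} {X : E} :
    IsCentralFlow γ X ↔
      IsOneParameterSubgroup (E := E) γ X ∧ ∀ t, γ t ∈ Subgroup.center N := by
  refine ⟨fun h ↦ ⟨⟨h.contMDiff, h.map_add, ?_⟩, h.mem_center⟩,
    fun ⟨⟨hsmooth, hadd, hX⟩, hc⟩ ↦ ⟨hsmooth, hadd, ?_, hc⟩⟩
  · have := congrArg (fun A : ℝ →L[ℝ] E ↦ A 1) h.hasModelDeriv.modelDeriv_eq
    rwa [ContinuousLinearMap.toSpanSingleton_apply, one_smul] at this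
  · convert hasModelDeriv_of_contMDiffAt (hsmooth 0) (by simp) using 1
    refine ContinuousLinearMap.ext_ring ?_
    rw [ContinuousLinearMap.toSpanSingleton_apply, one_smul]
    exact hX.symm

namespace IsCentralFlow

theorem map_zero {γ : ℝ → N} {X : E} (h : IsCentralFlow γ X) : γ 0 = 1 := by
  simpa using h.map_add 0 0

theorem comp_mul {γ : ℝ → N} {X : E} (hγ : IsCentralFlow γ X) (c : ℝ) :
    IsCentralFlow (fun t ↦ γ (c * t)) (c • X) := by
  have hc : ContDiff ℝ ∞ (fun t : ℝ ↦ c * t) := by fun_prop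
  refine ⟨hγ.contMDiff.comp hc.contMDiff, fun s t ↦ by rw [mul_add, hγ.map_add], ?_,
    fun t ↦ hγ.mem_center _⟩
  have hderiv : HasModelDeriv (fun t : ℝ ↦ c * t) (0 : ℝ) (c • ContinuousLinearMap.id ℝ ℝ) :=
    hasModelDeriv_iff_hasFDerivAt.2 ((hasFDerivAt_id _).const_smul c)
  convert hγ.hasModelDeriv.comp hderiv (mul_zero c) using 1
  ext; simp

theorem one : IsCentralFlow (fun _ : ℝ ↦ (1 : N)) (0 : E) := by
  refine ⟨contMDiff_const, fun _ _ ↦ (one_mul 1).symm, ?_, fun _ ↦ one_mem _⟩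
  rw [ContinuousLinearMap.toSpanSingleton_zero]
  exact hasMFDerivAt_const (I := 𝓘(ℝ, ℝ)) (I' := 𝓘(ℝ, E)) (1 : N) (0 : ℝ)

variable [LieGroup 𝓘(ℝ, E) ∞ N]

theorem mul {γ δ : ℝ → N} {X Y : E} (hγ : IsCentralFlow γ X) (hδ : IsCentralFlow δ Y) :
    IsCentralFlow (fun t ↦ γ t * δ t) (X + Y) := by
  refine ⟨hγ.contMDiff.mul hδ.contMDiff, fun s t ↦ ?_, ?_,
    fun t ↦ mul_mem (hγ.mem_center t) (hδ.mem_center t)⟩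
  · have hcomm : γ t * δ s = δ s * γ t := Subgroup.mem_center_iff.1 (hδ.mem_center s) (γ t)
    rw [hγ.map_add, hδ.map_add, mul_assoc, ← mul_assoc (γ t), hcomm]
    group
  · rw [ContinuousLinearMap.toSpanSingleton_add]
    exact hγ.hasModelDeriv.mul_of_eq_one hδ.hasModelDeriv hγ.map_zero hδ.map_zero

theorem eq_one {γ : ℝ → N} (h : IsCentralFlow γ (0 : E)) (t : ℝ) : γ t = 1 := by
  have : IsManifold 𝓘(ℝ, E) 1 N := .of_le (n := ∞) (by simp)
  have hderiv : ∀ t, HasModelDeriv γ t (0 : ℝ →L[ℝ] E) := by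
    intro t
    have hγ : γ = fun s ↦ γ (s - t) * γ t := by
      ext s
      rw [← h.map_add, sub_add_cancel]
    have hsub : HasModelDeriv (fun s : ℝ ↦ s - t) t (ContinuousLinearMap.id ℝ ℝ) :=
      hasModelDeriv_iff_hasFDerivAt.2 ((hasFDerivAt_id t).sub_const t)
    have hmul := hasModelDeriv_of_contMDiffAt
      (contMDiff_mul_right (I := 𝓘(ℝ, E)) (n := ∞) (a := γ t) (x := (1 : N))) (by simp)
    rw [hγ]
    convert (hmul.comp h.hasModelDeriv h.map_zero).comp hsub (sub_self t) using 1
    simp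
  rw [← h.map_zero]
  exact (isLocallyConstant_of_hasModelDeriv_zero hderiv).apply_eq_of_preconnectedSpace t 0

theorem unique {γ δ : ℝ → N} {X : E} (hγ : IsCentralFlow γ X) (hδ : IsCentralFlow δ X) :
    γ = δ := by
  ext t
  have h := hγ.mul (hδ.comp_mul (-1))
  rw [neg_one_smul, add_neg_cancel] at h
  have hinv : δ t * δ (-1 * t) = 1 := by
    rw [← hδ.map_add, ← hδ.map_zero]; congr 1; ring
  exact mul_right_cancel ((h.eq_one t).trans hinv.symm)

end IsCentralFlow

variable [LieGroup 𝓘(ℝ, E) ∞ N]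

variable (E N) in
/-- The Lie algebra of the center of `N`: the velocities of its one-parameter subgroups. -/
def centralLie : Submodule ℝ E where
  carrier := {X | ∃ γ : ℝ → N, IsCentralFlow γ X}
  add_mem' := fun ⟨_, hγ⟩ ⟨_, hδ⟩ ↦ ⟨_, hγ.mul hδ⟩
  zero_mem' := ⟨_, IsCentralFlow.one⟩
  smul_mem' := fun c _ ⟨_, hγ⟩ ↦ ⟨_, hγ.comp_mul c⟩

/-- The exponential map of the center of `N`: the time-one value of the one-parameter subgroup
with the given velocity. -/
def centralExp (X : centralLie E N) : N := X.2.choose 1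

theorem IsCentralFlow.centralExp_eq {γ : ℝ → N} {X : centralLie E N}
    (hγ : IsCentralFlow γ (X : E)) : centralExp X = γ 1 := by
  rw [centralExp, X.2.choose_spec.unique hγ]

theorem isCentralFlow_centralExp (X : centralLie E N) :
    IsCentralFlow (fun t : ℝ ↦ centralExp (t • X)) (X : E) := by
  obtain ⟨γ, hγ⟩ := X.2
  convert hγ using 2 with t
  rw [IsCentralFlow.centralExp_eq (X := t • X) (hγ.comp_mul t), mul_one]

theorem centralExp_add (X Y : centralLie E N) :
    centralExp (X + Y) = centralExp X * centralExp Y := by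
  have h := (isCentralFlow_centralExp X).mul (isCentralFlow_centralExp Y)
  rw [IsCentralFlow.centralExp_eq (X := X + Y) h, one_smul, one_smul]

variable (E N) in
/-- `centralExp` as a homomorphism from the additive group of the Lie algebra of the center. -/
def centralExpHom : centralLie E N →+ Additive N :=
  AddMonoidHom.mk' (fun X ↦ Additive.ofMul (centralExp X)) centralExp_add

@[simp]
theorem centralExp_zero : centralExp (0 : centralLie E N) = 1 :=
  map_zero (centralExpHom E N)

theorem centralExp_neg (X : centralLie E N) : centralExp (-X) = (centralExp X)⁻¹ :=
  map_neg (centralExpHom E N) X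

theorem centralExp_mem_center (X : centralLie E N) : centralExp X ∈ Subgroup.center N := by
  simpa only [one_smul] using (isCentralFlow_centralExp X).mem_center 1

theorem centralExp_mul_comm (X : centralLie E N) (y : N) :
    centralExp X * y = y * centralExp X :=
  (Subgroup.mem_center_iff.1 (centralExp_mem_center X) y).symm

variable [FiniteDimensional ℝ E]

theorem contMDiff_centralExp :
    ContMDiff 𝓘(ℝ, centralLie E N) 𝓘(ℝ, E) ∞ (centralExp : centralLie E N → N) := by
  let b := Module.finBasis ℝ (centralLie E N)
  suffices ∀ s : Finset (Fin (Module.finrank ℝ (centralLie E N))),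
      ContMDiff 𝓘(ℝ, centralLie E N) 𝓘(ℝ, E) ∞
        (fun X : centralLie E N ↦ centralExp (∑ i ∈ s, b.repr X i • b i)) by
    simpa only [b.sum_repr] using this Finset.univ
  intro s
  induction s using Finset.induction_on with
  | empty => simpa using contMDiff_const
  | insert i s hi ih =>
    simp only [Finset.sum_insert hi, centralExp_add]
    have hcoord : ContDiff ℝ ∞ (fun X : centralLie E N ↦ b.repr X i) :=
      (LinearMap.toContinuousLinearMap (b.coord i)).contDiff
    exact ((isCentralFlow_centralExp (b i)).contMDiff.comp hcoord.contMDiff).mul ih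

theorem hasModelDeriv_centralExp :
    HasModelDeriv (centralExp : centralLie E N → N) 0 (centralLie E N).subtypeL := by
  have hexp := hasModelDeriv_of_contMDiffAt (contMDiff_centralExp (E := E) (N := N) 0) (by simp)
  convert hexp using 1
  ext X
  have hline : HasModelDeriv (fun t : ℝ ↦ t • X) 0 (ContinuousLinearMap.toSpanSingleton ℝ X) :=
    hasModelDeriv_iff_hasFDerivAt.2 (ContinuousLinearMap.toSpanSingleton ℝ X).hasFDerivAt
  have heq := (hexp.comp hline (zero_smul ℝ X)).unique (isCentralFlow_centralExp X).hasModelDeriv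
  simpa using (congrArg (fun A : ℝ →L[ℝ] E ↦ A 1) heq).symm

end CentralExp

/-! ## The lattice in the Lie algebra of the center -/

section CentralLattice

variable {E : Type*} [NormedAddCommGroup E] [NormedSpace ℝ E]
  {N : Type*} [TopologicalSpace N] [ChartedSpace E N] [Group N]
  {Γ : Subgroup N}

namespace LatticeAut

/-- The differential of `L` at the identity as a continuous linear map of the model space. -/
def modelDifferential (L : LatticeAut E Γ) : E →L[ℝ] E := modelDeriv L.toMulEquiv 1

theorem hasModelDeriv (L : LatticeAut E Γ) : HasModelDeriv L.toMulEquiv 1 L.modelDifferential :=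
  hasModelDeriv_of_contMDiffAt (L.contMDiff_toFun 1) (by simp)

theorem modelDifferential_injective (L : LatticeAut E Γ) : Injective L.modelDifferential :=
  L.hasModelDeriv.injective_of_leftInverse
    (hasModelDeriv_of_contMDiffAt (L.contMDiff_invFun _) (by simp))
    (Eventually.of_forall L.toMulEquiv.symm_apply_apply)

theorem isCentralFlow_comp (L : LatticeAut E Γ) {γ : ℝ → N} {X : E} (hγ : IsCentralFlow γ X) :
    IsCentralFlow (fun t ↦ L.toMulEquiv (γ t)) (L.modelDifferential X) := by
  refine ⟨L.contMDiff_toFun.comp hγ.contMDiff, fun s t ↦ by rw [hγ.map_add, map_mul], ?_,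
    fun t ↦ (Subgroup.centerCongr L.toMulEquiv ⟨γ t, hγ.mem_center t⟩).2⟩
  convert L.hasModelDeriv.comp hγ.hasModelDeriv hγ.map_zero using 1
  ext; simp

variable [LieGroup 𝓘(ℝ, E) ∞ N]

/-- The action of `L` on the Lie algebra of the center. -/
def centralMap (L : LatticeAut E Γ) : centralLie E N →ₗ[ℝ] centralLie E N :=
  (L.modelDifferential : E →ₗ[ℝ] E).restrict fun _ ⟨_, hγ⟩ ↦ ⟨_, L.isCentralFlow_comp hγ⟩

theorem centralExp_centralMap (L : LatticeAut E Γ) (X : centralLie E N) :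
    centralExp (L.centralMap X) = L.toMulEquiv (centralExp X) := by
  rw [IsCentralFlow.centralExp_eq (X := L.centralMap X)
    (L.isCentralFlow_comp (isCentralFlow_centralExp X)), one_smul]

end LatticeAut

variable [LieGroup 𝓘(ℝ, E) ∞ N]

variable (E Γ) in
/-- The logarithms of the elements of `Γ` in the Lie algebra of the center. -/
def centralLattice : Submodule ℤ E :=
  AddSubgroup.toIntSubmodule
    ((Γ.toAddSubgroup.comap (centralExpHom E N)).map (centralLie E N).subtype.toAddMonoidHom)

theorem mem_centralLattice {X : E} :
    X ∈ centralLattice E Γ ↔ ∃ Y : centralLie E N, centralExp Y ∈ Γ ∧ (Y : E) = X :=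
  Iff.rfl

theorem coe_mem_centralLattice {X : centralLie E N} :
    (X : E) ∈ centralLattice E Γ ↔ centralExp X ∈ Γ := by
  simp [mem_centralLattice]

theorem centralLattice_subset_centralLie : (centralLattice E Γ : Set E) ⊆ centralLie E N := by
  rintro _ ⟨Y, -, rfl⟩
  exact Y.2

theorem LatticeAut.modelDifferential_mem_centralLattice (L : LatticeAut E Γ) {X : E}
    (hX : X ∈ centralLattice E Γ) : L.modelDifferential X ∈ centralLattice E Γ := by
  obtain ⟨Y, hY, rfl⟩ := mem_centralLattice.1 hX
  refine mem_centralLattice.2 ⟨L.centralMap Y, ?_, rfl⟩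
  rw [L.centralExp_centralMap, L.mem_iff]
  exact hY

variable (E Γ) in
theorem coe_centralLattice : (centralLattice E Γ : Set E) = (centralLog E Γ : Set E) := by
  ext X
  constructor
  · rintro ⟨Y, hY, rfl⟩
    obtain ⟨hsub, hcenter⟩ := isCentralFlow_iff.1 (isCentralFlow_centralExp Y)
    exact ⟨_, hsub, hcenter, by rwa [one_smul]⟩
  · rintro ⟨γ, hsub, hcenter, hγ⟩
    have hflow : IsCentralFlow γ (show E from X) := isCentralFlow_iff.2 ⟨hsub, hcenter⟩
    refine mem_centralLattice.2 ⟨⟨X, γ, hflow⟩, ?_, rfl⟩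
    rwa [IsCentralFlow.centralExp_eq (by exact hflow)]

variable [FiniteDimensional ℝ E]

theorem eventually_eq_zero_of_centralExp_mem [DiscreteTopology Γ] :
    ∀ᶠ X : centralLie E N in 𝓝 0, centralExp X ∈ Γ → X = 0 := by
  have hexp : (fun X : centralLie E N ↦ X - 0) =O[𝓝 0] fun X ↦
      chartAt E (centralExp 0) (centralExp X) - chartAt E (centralExp 0) (centralExp 0) :=
    hasModelDeriv_centralExp.isBigO_sub_rev Subtype.val_injective
  obtain ⟨C, hC⟩ := hexp.bound
  obtain ⟨U, hU, hUΓ⟩ := (discreteTopology_subtype_iff' (S := (Γ : Set N))).1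
    inferInstance 1 (one_mem Γ)
  have hcont : ContinuousAt (centralExp : centralLie E N → N) 0 :=
    contMDiff_centralExp.continuous.continuousAt
  have hmem : centralExp (0 : centralLie E N) ∈ U := by
    rw [centralExp_zero]
    exact (hUΓ.symm.subset (mem_singleton (1 : N))).1
  filter_upwards [hC, hcont.eventually (hU.mem_nhds hmem)] with X hX hXU hXΓ
  have hX1 : centralExp X = 1 := hUΓ.subset ⟨hXU, hXΓ⟩
  rw [hX1, centralExp_zero, sub_self, norm_zero, mul_zero, sub_zero] at hX
  exact norm_le_zero_iff.1 hX

instance discreteTopology_centralLattice [DiscreteTopology Γ] :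
    DiscreteTopology (centralLattice E Γ) := by
  refine discreteTopology_of_isOpen_singleton_zero ?_
  let ι : centralLattice E Γ → centralLie E N := inclusion centralLattice_subset_centralLie
  have hι : Continuous ι := continuous_inclusion centralLattice_subset_centralLie
  have hzero : ∀ᶠ X : centralLattice E Γ in 𝓝 0, X = 0 := by
    filter_upwards [hι.continuousAt.eventually (eventually_eq_zero_of_centralExp_mem (Γ := Γ))]
      with X hX
    have hιX : ι X = 0 := hX (coe_mem_centralLattice.1 X.2)
    exact Subtype.ext (congrArg (Subtype.val : centralLie E N → E) hιX)
  exact (isOpen_singleton_iff_nhds_eq_pure _).2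
    (le_antisymm (le_pure_iff.2 hzero) (pure_le_nhds _))

end CentralLattice

/-! ## Invariant subspaces and invariant lattices -/

section DistinctModuli

open Module Polynomial

theorem splits_of_nodup_norm_aroots {p : ℝ[X]} (h : ((p.aroots ℂ).map (‖·‖)).Nodup) :
    p.Splits := by
  refine Splits.of_splits_map (algebraMap ℝ ℂ) (IsAlgClosed.splits _) fun z hz ↦ ⟨z.re, ?_⟩
  have hz' : (starRingEnd ℂ) z ∈ p.aroots ℂ := by
    obtain ⟨hp, hpz⟩ := mem_aroots.1 hz
    exact mem_aroots.2 ⟨hp, by rw [aeval_conj, hpz, map_zero]⟩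
  exact Complex.conj_eq_iff_re.1 (Multiset.inj_on_of_nodup_map h _ hz' _ hz (by simp))

theorem exists_basis_hasEigenvector_of_splits {K V : Type*} [Field K] [AddCommGroup V] [Module K V]
    [FiniteDimensional K V] (A : End K V) (hs : A.charpoly.Splits) (hn : A.charpoly.roots.Nodup) :
    ∃ b : Basis {a // a ∈ A.charpoly.roots} K V,
      ∀ a : {a // a ∈ A.charpoly.roots}, A.HasEigenvector a (b a) := by
  classical
  have heig (a : {a // a ∈ A.charpoly.roots}) : ∃ v, A.HasEigenvector a v :=
    ((End.hasEigenvalue_iff_isRoot_charpoly A _).2 (isRoot_of_mem_roots a.2)).exists_hasEigenvector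
  choose v hv using heig
  have hcard : Fintype.card {a // a ∈ A.charpoly.roots} = finrank K V := by
    rw [Fintype.card_of_subtype A.charpoly.roots.toFinset fun _ ↦ Multiset.mem_toFinset,
      Multiset.toFinset_card_of_nodup hn, ← hs.natDegree_eq_card_roots, A.charpoly_natDegree]
  exact ⟨basisOfLinearIndependentOfCardEqFinrank'
    v (End.eigenvectors_linearIndependent' A _ Subtype.val_injective v hv) hcard, by simpa using hv⟩

theorem exists_eigenbasis_of_nodup_norm {V : Type*} [AddCommGroup V] [Module ℝ V]
    [FiniteDimensional ℝ V] (A : End ℝ V) (h : ((A.charpoly.aroots ℂ).map (‖·‖)).Nodup) :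
    ∃ (ι : Type) (_ : Finite ι) (b : Basis ι ℝ V) (l : ι → ℝ),
      (∀ i, A.HasEigenvector (l i) (b i)) ∧ Injective (fun i ↦ |l i|) ∧
        ∀ i, (l i : ℂ) ∈ A.charpoly.aroots ℂ := by
  have hs := splits_of_nodup_norm_aroots h
  have hroots : A.charpoly.aroots ℂ = A.charpoly.roots.map (algebraMap ℝ ℂ) := hs.roots_map _
  rw [hroots, Multiset.map_map] at h
  obtain ⟨b, hb⟩ := exists_basis_hasEigenvector_of_splits A hs (h.of_map _)
  refine ⟨_, inferInstance, b, Subtype.val, hb, fun i j hij ↦ Subtype.ext ?_, fun i ↦ ?_⟩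
  · exact Multiset.inj_on_of_nodup_map h _ i.2 _ j.2 (by simpa using hij)
  · exact hroots ▸ Multiset.mem_map_of_mem _ i.2

end DistinctModuli

section Eigenbasis

open Module Polynomial

variable {k K V : Type*} [Field k] [Field K] [Algebra k K] [AddCommGroup V] [Module k V]

theorem apply_aeval_of_apply_eq_mul {T : End k V} {F : V →ₗ[k] K} {a : K}
    (hF : ∀ x, F (T x) = a * F x) (p : k[X]) (x : V) : F (aeval T p x) = aeval a p * F x := by
  have hpow (n : ℕ) : F ((T ^ n) x) = a ^ n * F x := by
    induction n with
    | zero => simp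
    | succ n ih => rw [pow_succ', End.mul_apply, hF, ih, pow_succ', mul_assoc]
  induction p using Polynomial.induction_on' with
  | add p q hp hq => rw [map_add, LinearMap.add_apply, map_add, hp, hq, map_add, add_mul]
  | monomial n c =>
    rw [aeval_monomial, aeval_monomial, End.mul_apply, algebraMap_end_apply, map_smul, hpow,
      Algebra.smul_def, mul_assoc]

variable [Module K V] {ι : Type*} {A : End K V} {b : Basis ι K V} {l : ι → K}

theorem repr_apply_of_hasEigenvector (hb : ∀ i, A.HasEigenvector (l i) (b i)) (x : V) (i : ι) :
    b.repr (A x) i = l i * b.repr x i := by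
  have h : b.coord i ∘ₗ A = l i • b.coord i := by
    refine b.ext fun j ↦ ?_
    rcases eq_or_ne j i with rfl | hj
    · simp [(hb j).apply_eq_smul]
    · simp [(hb j).apply_eq_smul, Finsupp.single_eq_of_ne hj.symm]
  exact LinearMap.congr_fun h x

theorem repr_pow_apply_of_hasEigenvector (hb : ∀ i, A.HasEigenvector (l i) (b i)) (n : ℕ) (x : V)
    (i : ι) : b.repr ((A ^ n) x) i = l i ^ n * b.repr x i :=
  repr_apply_of_hasEigenvector (A := A ^ n) (l := fun i ↦ l i ^ n)
    (fun i ↦ ⟨End.mem_eigenspace_iff.2 ((hb i).pow_apply n), (hb i).2⟩) x i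

theorem basis_mem_of_mem_invariant (hb : ∀ i, A.HasEigenvector (l i) (b i)) (hl : Injective l)
    {S : Submodule K V} (hS : S ≤ S.comap A) {x : V} (hx : x ∈ S) {i : ι} (hi : b.repr x i ≠ 0) :
    b i ∈ S := by
  classical
  -- This polynomial in `A` kills every component of `x` except the `i`-th one.
  let p : K[X] := ∏ j ∈ (b.repr x).support.erase i, (X - C (l j))
  have hp (j : ι) : p.eval (l j) = ∏ m ∈ (b.repr x).support.erase i, (l j - l m) := by
    simp [p, eval_prod]
  have hpi : p.eval (l i) ≠ 0 := by
    rw [hp]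
    exact Finset.prod_ne_zero_iff.2 fun j hj ↦
      sub_ne_zero.2 fun hij ↦ Finset.ne_of_mem_erase hj (hl hij).symm
  have hpx : aeval A p x = (p.eval (l i) * b.repr x i) • b i := by
    refine b.ext_elem fun j ↦ ?_
    have hj : b.repr (aeval A p x) j = p.eval (l j) * b.repr x j := by
      simpa [aeval_def] using apply_aeval_of_apply_eq_mul (F := b.coord j)
        (fun y ↦ repr_apply_of_hasEigenvector hb y j) p x
    rcases eq_or_ne j i with rfl | hji
    · simp [hj]
    · have : p.eval (l j) * b.repr x j = 0 := by
        by_contra h0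
        have hjs := Finset.mem_erase.2 ⟨hji, Finsupp.mem_support_iff.2 (right_ne_zero_of_mul h0)⟩
        exact left_ne_zero_of_mul h0 (by rw [hp, Finset.prod_eq_zero hjs (sub_self _)])
      simp [hj, this, Finsupp.single_eq_of_ne hji]
  have hmem : aeval A p x ∈ S := p.aeval_apply_smul_mem_of_le_comap hx A hS
  exact (S.smul_mem_iff (mul_ne_zero hpi hi)).1 (hpx ▸ hmem)

theorem exists_conj_add_smul_basis (hb : ∀ i, A.HasEigenvector (l i) (b i)) {i₀ : ι}
    (hl : ∀ i ≠ i₀, l i ≠ l i₀) {ℓ : V →ₗ[K] K} (hℓ : ℓ (b i₀) = 0) :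
    ∃ P : V ≃ₗ[K] V, ∀ x, P (A x + ℓ x • b i₀) = A (P x) := by
  let m : V →ₗ[K] K := b.constr K fun i ↦ ℓ (b i) / (l i₀ - l i)
  have hm (i : ι) : m (b i) = ℓ (b i) / (l i₀ - l i) := b.constr_basis K _ i
  have hm₀ : m (b i₀) = 0 := by rw [hm, hℓ, zero_div]
  have hmA : m ∘ₗ A + ℓ = l i₀ • m := by
    refine b.ext fun i ↦ ?_
    rcases eq_or_ne i i₀ with rfl | hi
    · simp [hm₀, hℓ, (hb i).apply_eq_smul]
    · have : l i₀ - l i ≠ 0 := sub_ne_zero.2 (hl i hi).symm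
      simp only [LinearMap.add_apply, LinearMap.comp_apply, (hb i).apply_eq_smul, map_smul, hm,
        LinearMap.smul_apply, smul_eq_mul]
      field_simp
      ring
  refine ⟨LinearEquiv.transvection hm₀, fun x ↦ ?_⟩
  have hmx : m (A x) + ℓ x = l i₀ * m x := LinearMap.congr_fun hmA x
  simp only [LinearEquiv.transvection.apply, map_add, map_smul, hm₀, (hb i₀).apply_eq_smul,
    smul_smul, mul_comm (m x), ← hmx]
  module

theorem isFinitelySemisimple_restrictScalars [IsScalarTower k K V]
    (hb : ∀ i, A.HasEigenvector (l i) (b i)) :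
    End.IsFinitelySemisimple (A.restrictScalars k) := by
  refine End.isFinitelySemisimple_iff'.2 fun U hU _ ↦ ?_
  set T : End k U := (A.restrictScalars k).restrict hU
  have hcoord (p : k[X]) (x : U) (i : ι) :
      b.repr (aeval T p x : U) i = aeval (l i) p * b.repr x i :=
    apply_aeval_of_apply_eq_mul (F := (b.coord i).restrictScalars k ∘ₗ U.subtype)
      (fun y ↦ repr_apply_of_hasEigenvector hb y i) p x
  have hsq : Squarefree (minpoly k T) := by
    refine IsRadical.squarefree (minpoly.ne_zero (Algebra.IsIntegral.isIntegral T)) ?_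
    intro n p hp
    refine minpoly.dvd k T (LinearMap.ext fun x ↦ Subtype.ext (b.ext_elem fun i ↦ ?_))
    have hpn : aeval (l i) p ^ n * b.repr x i = 0 := by
      rw [← map_pow, ← hcoord, (minpoly.dvd_iff).1 hp]
      simp
    simpa [hcoord] using (mul_eq_zero.1 hpn).imp_left eq_zero_of_pow_eq_zero
  exact End.isSemisimple_of_squarefree_aeval_eq_zero hsq (minpoly.aeval k T)

end Eigenbasis

section ExtensionOfScalars

open Module

variable {R S M : Type*} [CommRing R] [CommRing S] [Algebra R S] [AddCommGroup M] [Module R M]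
  [Module S M] [IsScalarTower R S M]

theorem exists_span_range_eq_span (P : Submodule R M) [Module.Free R P] :
    ∃ v : Free.ChooseBasisIndex R P → M,
      Submodule.span S (range v) = Submodule.span S (P : Set M) := by
  let b := Free.chooseBasis R P
  have hspan : Submodule.span R (range fun i ↦ (b i : M)) = P := by
    rw [range_comp' Subtype.val b, ← P.coe_subtype, ← Submodule.map_span, b.span_eq,
      Submodule.map_subtype_top]
  exact ⟨fun i ↦ b i, by rw [← Submodule.span_span_of_tower R S, hspan]⟩

theorem finite_span_of_finite (P : Submodule R M) [Module.Finite R P] :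
    Module.Finite S (Submodule.span S (P : Set M)) := by
  obtain ⟨s, hs⟩ := (Module.Finite.iff_fg (N := P)).1 inferInstance
  rw [← hs, Submodule.span_span_of_tower]
  exact Module.Finite.span_of_finite S s.finite_toSet

theorem finrank_span_le_finrank [Nontrivial R] [StrongRankCondition S] (P : Submodule R M)
    [Module.Free R P] [Module.Finite R P] :
    finrank S (Submodule.span S (P : Set M)) ≤ finrank R P := by
  obtain ⟨v, hv⟩ := exists_span_range_eq_span (S := S) P
  rw [← hv, finrank_eq_card_chooseBasisIndex R P]
  exact finrank_range_le_card v

end ExtensionOfScalars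

section FieldExtension

open Module

variable {k K V : Type*} [Field k] [Field K] [Algebra k K] [AddCommGroup V] [Module k V]
  [Module K V] [IsScalarTower k K V]

theorem disjoint_span_of_finrank_sup_le {U W : Submodule k V} [Module.Finite k U]
    [Module.Finite k W] (h : Disjoint U W)
    (hr : finrank k ↥(U ⊔ W) ≤ finrank K (Submodule.span K (↑(U ⊔ W) : Set V))) :
    Disjoint (Submodule.span K (U : Set V)) (Submodule.span K (W : Set V)) := by
  have := finite_span_of_finite (S := K) U
  have := finite_span_of_finite (S := K) W
  have hsup : Submodule.span K (↑(U ⊔ W) : Set V) =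
      Submodule.span K (U : Set V) ⊔ Submodule.span K (W : Set V) := by
    rw [← Submodule.span_union, ← Submodule.span_span_of_tower k K ((U : Set V) ∪ W),
      Submodule.span_union, Submodule.span_eq, Submodule.span_eq]
  have hk := Submodule.finrank_sup_add_finrank_inf_eq U W
  have hK := Submodule.finrank_sup_add_finrank_inf_eq
    (Submodule.span K (U : Set V)) (Submodule.span K (W : Set V))
  have hU := finrank_span_le_finrank (S := K) U
  have hW := finrank_span_le_finrank (S := K) W
  rw [h.eq_bot, finrank_bot] at hk
  rw [hsup] at hr
  rw [disjoint_iff, ← Submodule.finrank_eq_zero (R := K)]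
  omega

theorem span_le_comap_of_le_comap {A : End K V} {U : Submodule k V}
    (hU : U ∈ End.invtSubmodule (A.restrictScalars k)) :
    Submodule.span K (U : Set V) ≤ (Submodule.span K (U : Set V)).comap A :=
  Submodule.span_le.2 fun _ hx ↦ Submodule.subset_span (hU hx)

end FieldExtension

section RationalSpan

open Module

variable {V : Type*} [AddCommGroup V] [Module ℚ V] {Λ : Submodule ℤ V}

theorem exists_nsmul_mem_of_mem_span_rat {x : V} (hx : x ∈ Submodule.span ℚ (Λ : Set V)) :
    ∃ n : ℕ, n ≠ 0 ∧ n • x ∈ Λ := by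
  induction hx using Submodule.span_induction with
  | mem x hx => exact ⟨1, one_ne_zero, by simpa using hx⟩
  | zero => exact ⟨1, one_ne_zero, by simp⟩
  | add x y _ _ hx hy =>
    obtain ⟨n, hn, hx⟩ := hx
    obtain ⟨m, hm, hy⟩ := hy
    refine ⟨m * n, mul_ne_zero hm hn, ?_⟩
    rw [smul_add, mul_smul, mul_comm, mul_smul]
    exact add_mem (nsmul_mem hx m) (nsmul_mem hy n)
  | smul a x _ hx =>
    obtain ⟨n, hn, hx⟩ := hx
    refine ⟨n * a.den, mul_ne_zero hn a.den_nz, ?_⟩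
    have hclear : (n * a.den) • a • x = a.num • n • x := by
      simp only [← Nat.cast_smul_eq_nsmul ℚ, ← Int.cast_smul_eq_zsmul ℚ, smul_smul]
      rw [Nat.cast_mul, mul_assoc, Rat.den_mul_eq_num, mul_comm]
    rw [hclear]
    exact Λ.smul_mem _ hx

theorem span_le_span_span_inter {K : Type*} [Field K] [CharZero K] [Module K V]
    {U : Submodule ℚ V} (hU : U ≤ Submodule.span ℚ (Λ : Set V)) :
    Submodule.span K (U : Set V) ≤
      Submodule.span K ((Submodule.span K (U : Set V) : Set V) ∩ Λ) := by
  refine Submodule.span_le.2 fun x hx ↦ ?_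
  obtain ⟨n, hn, hnx⟩ := exists_nsmul_mem_of_mem_span_rat (hU hx)
  have hmem : (n : K) • x ∈ Submodule.span K ((Submodule.span K (U : Set V) : Set V) ∩ Λ) := by
    rw [Nat.cast_smul_eq_nsmul]
    exact Submodule.subset_span ⟨nsmul_mem (Submodule.subset_span hx) n, hnx⟩
  exact (Submodule.smul_mem_iff _ (Nat.cast_ne_zero.2 hn)).1 hmem

end RationalSpan

section DiscreteSubgroup

open Module

variable {E : Type*} [NormedAddCommGroup E] [NormedSpace ℝ E] {ι : Type*} {A : End ℝ E}
  {b : Basis ι ℝ E} {l : ι → ℝ}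

theorem tendsto_pow_apply_zero [Finite ι] (hb : ∀ i, A.HasEigenvector (l i) (b i)) {x : E}
    (hx : ∀ i, b.repr x i ≠ 0 → |l i| < 1) : Tendsto (fun n : ℕ ↦ (A ^ n) x) atTop (𝓝 0) := by
  cases nonempty_fintype ι
  have hexp (n : ℕ) : (A ^ n) x = ∑ i, (l i ^ n * b.repr x i) • b i := by
    simp_rw [← repr_pow_apply_of_hasEigenvector hb, b.sum_repr]
  simp_rw [hexp]
  rw [show (0 : E) = ∑ i : ι, (0 * b.repr x i) • b i by simp]
  refine tendsto_finsetSum _ fun i _ ↦ ?_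
  rcases eq_or_ne (b.repr x i) 0 with hi | hi
  · simp [hi]
  · exact ((tendsto_pow_atTop_nhds_zero_of_abs_lt_one (hx i hi)).mul_const _).smul_const _

variable {Λ : Submodule ℤ E}

theorem exists_one_le_abs_of_mem_discrete [Finite ι] (hb : ∀ i, A.HasEigenvector (l i) (b i))
    (hA : Injective A) [DiscreteTopology Λ] (hΛ : ∀ x ∈ Λ, A x ∈ Λ) {x : E} (hx : x ∈ Λ)
    (hx₀ : x ≠ 0) : ∃ i, b.repr x i ≠ 0 ∧ 1 ≤ |l i| := by
  by_contra! hsmall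
  have hmem (n : ℕ) : (A ^ n) x ∈ Λ := by
    induction n with
    | zero => simpa
    | succ n ih => rw [pow_succ', End.mul_apply]; exact hΛ _ ih
  have hlim : Tendsto (fun n ↦ (⟨(A ^ n) x, hmem n⟩ : Λ)) atTop (𝓝 0) :=
    tendsto_subtype_rng.2 (tendsto_pow_apply_zero hb hsmall)
  rw [nhds_discrete, tendsto_pure] at hlim
  obtain ⟨n, hn⟩ := hlim.exists
  have hAn : Injective (A ^ n) := by rw [End.coe_pow]; exact hA.iterate n
  exact hx₀ (hAn (by simpa using congrArg Subtype.val hn))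

theorem finrank_span_rat_le [FiniteDimensional ℝ E] [Module ℚ E] (Λ : Submodule ℤ E)
    [DiscreteTopology Λ] :
    finrank ℚ (Submodule.span ℚ (Λ : Set E)) ≤ finrank ℝ (Submodule.span ℝ (Λ : Set E)) := by
  have hrank := Real.finrank_eq_int_finrank_of_discrete (s := (Λ : Set E))
    (by rwa [Submodule.span_eq])
  rw [Set.finrank, Set.finrank, Submodule.span_eq] at hrank
  exact (finrank_span_le_finrank Λ).trans hrank.ge

variable [Module ℚ E]

theorem exists_expanding_mem_span [Finite ι] (hb : ∀ i, A.HasEigenvector (l i) (b i))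
    (hA : Injective A) (hl : Injective l) (h1 : ∀ i, |l i| ≠ 1) [DiscreteTopology Λ]
    (hΛ : ∀ x ∈ Λ, A x ∈ Λ) {U : Submodule ℚ E} (hU₀ : U ≠ ⊥)
    (hU : U ≤ Submodule.span ℚ (Λ : Set E)) (hAU : U ∈ End.invtSubmodule (A.restrictScalars ℚ)) :
    ∃ i, b i ∈ Submodule.span ℝ (U : Set E) ∧ 1 < |l i| := by
  obtain ⟨x, hxU, hx₀⟩ := U.exists_mem_ne_zero_of_ne_bot hU₀
  obtain ⟨n, hn, hnx⟩ := exists_nsmul_mem_of_mem_span_rat (hU hxU)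
  have hnx₀ : n • x ≠ 0 := by
    rw [← Nat.cast_smul_eq_nsmul ℚ]
    exact smul_ne_zero (Nat.cast_ne_zero.2 hn) hx₀
  obtain ⟨i, hi, hli⟩ := exists_one_le_abs_of_mem_discrete hb hA hΛ hnx hnx₀
  exact ⟨i, basis_mem_of_mem_invariant hb hl (span_le_comap_of_le_comap hAU)
    (nsmul_mem (Submodule.subset_span hxU) n) hi, hli.lt_of_ne (h1 i).symm⟩

theorem exists_invariant_complement [FiniteDimensional ℝ E]
    (hb : ∀ i, A.HasEigenvector (l i) (b i)) [DiscreteTopology Λ] (hΛ : ∀ x ∈ Λ, A x ∈ Λ)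
    {W : Submodule ℚ E} (hW : W ≤ Submodule.span ℚ (Λ : Set E))
    (hAW : W ∈ End.invtSubmodule (A.restrictScalars ℚ)) :
    ∃ U ∈ End.invtSubmodule (A.restrictScalars ℚ), U ⊔ W = Submodule.span ℚ (Λ : Set E) ∧
      Disjoint (Submodule.span ℝ (U : Set E)) (Submodule.span ℝ (W : Set E)) := by
  have hfin : Module.Finite ℚ (Submodule.span ℚ (Λ : Set E)) := finite_span_of_finite Λ
  have hAV : Submodule.span ℚ (Λ : Set E) ∈ End.invtSubmodule (A.restrictScalars ℚ) :=
    Submodule.span_le.2 fun x hx ↦ Submodule.subset_span (hΛ x hx)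
  obtain ⟨U, hUV, hAU, hdisj, hsup⟩ := End.isFinitelySemisimple_iff.1
    (isFinitelySemisimple_restrictScalars hb) _ hAV hfin W hAW hW
  have hUfin := Submodule.finiteDimensional_of_le hUV
  have hWfin := Submodule.finiteDimensional_of_le hW
  rw [sup_comm] at hsup
  refine ⟨U, hAU, hsup, disjoint_span_of_finrank_sup_le hdisj.symm ?_⟩
  rw [hsup, Submodule.span_span_of_tower]
  exact finrank_span_rat_le Λ

theorem span_le_span_of_le_span {U : Submodule ℚ E} (hU : U ≤ Submodule.span ℚ (Λ : Set E)) :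
    Submodule.span ℝ (U : Set E) ≤ Submodule.span ℝ (Λ : Set E) :=
  (span_le_span_span_inter hU).trans (Submodule.span_mono inter_subset_right)

theorem exists_expanding_pair [FiniteDimensional ℝ E] [Finite ι]
    (hb : ∀ i, A.HasEigenvector (l i) (b i)) (hA : Injective A)
    (hl : Injective (fun i ↦ |l i|)) (h1 : ∀ i, |l i| ≠ 1) [DiscreteTopology Λ]
    (hΛ : ∀ x ∈ Λ, A x ∈ Λ) {W : Submodule ℚ E} (hW₀ : W ≠ ⊥)
    (hW : W < Submodule.span ℚ (Λ : Set E)) (hAW : ∀ x ∈ W, A x ∈ W) :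
    ∃ (i j : ι) (S : Submodule ℝ E), 1 < |l i| ∧ |l i| < |l j| ∧
      S ≤ Submodule.span ℝ ((S : Set E) ∩ Λ) ∧ b i ∈ S ∧
        b j ∈ Submodule.span ℝ (Λ : Set E) ∧ b j ∉ S := by
  obtain ⟨U, hAU, hsup, hdisj⟩ := exists_invariant_complement hb hΛ hW.le hAW
  have hU : U ≤ Submodule.span ℚ (Λ : Set E) := hsup ▸ le_sup_left
  have hU₀ : U ≠ ⊥ := by
    rintro rfl
    exact hW.ne (by rw [← hsup, bot_sup_eq])
  have hl' : Injective l := fun i j hij ↦ hl (congrArg abs hij)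
  obtain ⟨i, hiU, hi⟩ := exists_expanding_mem_span hb hA hl' h1 hΛ hU₀ hU hAU
  obtain ⟨j, hjW, hj⟩ := exists_expanding_mem_span hb hA hl' h1 hΛ hW₀ hW.le hAW
  have hjU : b j ∉ Submodule.span ℝ (U : Set E) := fun h ↦
    b.ne_zero j (Submodule.disjoint_def.1 hdisj _ h hjW)
  have hiW : b i ∉ Submodule.span ℝ (W : Set E) := fun h ↦
    b.ne_zero i (Submodule.disjoint_def.1 hdisj _ hiU h)
  have hij : |l i| ≠ |l j| := fun h ↦ hjU (hl h ▸ hiU)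
  rcases hij.lt_or_gt with hlt | hlt
  · exact ⟨i, j, _, hi, hlt, span_le_span_span_inter hU, hiU,
      span_le_span_of_le_span hW.le hjW, hjU⟩
  · exact ⟨j, i, _, hj, hlt, span_le_span_span_inter hW.le, hjW,
      span_le_span_of_le_span hU hiU, hiW⟩

end DiscreteSubgroup

/-! ## The central action on the quotient -/

section Action

variable {E : Type*} [NormedAddCommGroup E] [NormedSpace ℝ E]
  {N : Type*} [TopologicalSpace N] [ChartedSpace E N] [Group N] {Γ : Subgroup N}

theorem LatticeAut.quotientEquiv_smul (L : LatticeAut E Γ) (y : N) (q : N ⧸ Γ) :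
    L.quotientEquiv (y • q) = L.toMulEquiv y • L.quotientEquiv q := by
  obtain ⟨x, rfl⟩ := QuotientGroup.mk_surjective q
  rw [MulAction.Quotient.smul_mk, smul_eq_mul, L.quotientEquiv_mk, L.quotientEquiv_mk, map_mul]
  rfl

variable [LieGroup 𝓘(ℝ, E) ∞ N]

theorem centralExp_smul_comm (X : centralLie E N) (y : N) (q : N ⧸ Γ) :
    centralExp X • y • q = y • centralExp X • q := by
  rw [smul_smul, smul_smul, centralExp_mul_comm]

theorem centralExp_add_smul (X Y : centralLie E N) (q : N ⧸ Γ) :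
    centralExp (X + Y) • q = centralExp X • centralExp Y • q := by
  rw [smul_smul, centralExp_add]

theorem centralExp_smul_of_mem {X : centralLie E N} (hX : centralExp X ∈ Γ) (q : N ⧸ Γ) :
    centralExp X • q = q := by
  obtain ⟨x, rfl⟩ := QuotientGroup.mk_surjective q
  rw [MulAction.Quotient.smul_mk, smul_eq_mul, centralExp_mul_comm]
  exact QuotientGroup.mk_mul_of_mem x hX

theorem LatticeAut.quotientEquiv_centralExp_smul (L : LatticeAut E Γ) (X : centralLie E N)
    (q : N ⧸ Γ) :
    L.quotientEquiv (centralExp X • q) = centralExp (L.centralMap X) • L.quotientEquiv q := by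
  rw [L.quotientEquiv_smul, L.centralExp_centralMap]

variable [DiscreteTopology Γ]

variable (E) in
theorem t2Space_quotient [FiniteDimensional ℝ E] : T2Space (N ⧸ Γ) := by
  have : IsTopologicalGroup N := topologicalGroup_of_lieGroup 𝓘(ℝ, E) ∞
  have : T1Space N := ChartedSpace.t1Space E N
  have : IsClosed (Γ : Set N) := Γ.isClosed_of_discrete
  exact QuotientGroup.instT2Space

theorem eventually_mk_quotientSection (q : N ⧸ Γ) :
    ∀ᶠ z in 𝓝 q, ((quotientSection (E := E) Γ q z : N) : N ⧸ Γ) = z := by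
  filter_upwards [(quotientSection (E := E) Γ q).open_source.mem_nhds (mem_chart_source E q).1]
    with z hz
  exact (isLocalHomeomorph_quotientMk E Γ).apply_localInverseAt_of_mem hz

theorem contMDiff_smul_quotient :
    ContMDiff (𝓘(ℝ, E).prod 𝓘(ℝ, E)) 𝓘(ℝ, E) ∞ (fun p : N × (N ⧸ Γ) ↦ p.1 • p.2) := by
  rintro ⟨y, q⟩
  have hsection : ContMDiffAt (𝓘(ℝ, E).prod 𝓘(ℝ, E)) 𝓘(ℝ, E) ∞
      (fun p : N × (N ⧸ Γ) ↦ quotientSection (E := E) Γ q p.2) (y, q) :=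
    ContMDiffAt.comp (y, q) (contMDiffAt_quotientSection (E := E) Γ q) contMDiffAt_snd
  refine ((contMDiff_quotientMk (E := E) Γ).contMDiffAt.comp (y, q)
    (contMDiffAt_fst.mul hsection)).congr_of_eventuallyEq ?_
  filter_upwards [continuousAt_snd.eventually (eventually_mk_quotientSection (E := E) q)] with p hp
  exact congrArg (p.1 • ·) hp.symm

theorem hasModelDeriv_orbit (q : N ⧸ Γ) :
    HasModelDeriv (fun y : N ↦ y • q) 1 (modelDeriv (fun y : N ↦ y • q) 1 : E →L[ℝ] E) :=
  hasModelDeriv_of_contMDiffAt (n := ∞)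
    (contMDiff_smul_quotient.comp (contMDiff_id.prodMk contMDiff_const) 1) (by simp)

theorem modelDeriv_orbit_injective (q : N ⧸ Γ) :
    Injective (modelDeriv (fun y : N ↦ y • q) 1 : E →L[ℝ] E) := by
  obtain ⟨x, rfl⟩ := QuotientGroup.mk_surjective q
  obtain ⟨γ, hγ⟩ := quotientSection_mk_eventuallyEq (E := E) Γ (x : N ⧸ Γ) x
    (mem_chart_source E (x : N ⧸ Γ)).1
  have hinv : ContMDiffAt 𝓘(ℝ, E) 𝓘(ℝ, E) ∞
      (fun z ↦ quotientSection (E := E) Γ (x : N ⧸ Γ) z * (x * γ)⁻¹) ((1 : N) • (x : N ⧸ Γ)) := by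
    rw [one_smul]
    exact (contMDiffAt_quotientSection (E := E) Γ (x : N ⧸ Γ)).mul contMDiffAt_const
  refine (hasModelDeriv_orbit (x : N ⧸ Γ)).injective_of_leftInverse
    (hasModelDeriv_of_contMDiffAt hinv (by simp)) ?_
  have : IsTopologicalGroup N := topologicalGroup_of_lieGroup 𝓘(ℝ, E) ∞
  have hx : Tendsto (fun y : N ↦ y * x) (𝓝 1) (𝓝 x) := by
    simpa only [one_mul] using (continuous_mul_const x).tendsto 1
  filter_upwards [hx.eventually hγ] with y hy
  rw [MulAction.Quotient.smul_mk, smul_eq_mul, hy]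
  group

variable [FiniteDimensional ℝ E]

/-- The derivative at the identity of the orbit map `y ↦ y • q`. -/
def orbitDeriv (q : N ⧸ Γ) : E ≃L[ℝ] E :=
  (LinearEquiv.ofInjectiveEndo (modelDeriv (fun y : N ↦ y • q) 1 : E →L[ℝ] E).toLinearMap
    (modelDeriv_orbit_injective q)).toContinuousLinearEquiv

theorem coe_orbitDeriv (q : N ⧸ Γ) :
    (orbitDeriv (E := E) q : E →L[ℝ] E) = modelDeriv (fun y : N ↦ y • q) 1 := by
  ext; rfl

theorem contMDiff_centralExp_smul :
    ContMDiff (𝓘(ℝ, centralLie E N).prod 𝓘(ℝ, E)) 𝓘(ℝ, E) ∞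
      (fun p : centralLie E N × (N ⧸ Γ) ↦ centralExp p.1 • p.2) :=
  contMDiff_smul_quotient.comp ((contMDiff_centralExp.comp contMDiff_fst).prodMk contMDiff_snd)

theorem hasModelDeriv_centralExp_smul (q : N ⧸ Γ) :
    HasModelDeriv (fun X : centralLie E N ↦ centralExp X • q) 0
      ((orbitDeriv (E := E) q : E →L[ℝ] E).comp (centralLie E N).subtypeL) := by
  rw [coe_orbitDeriv]
  exact (hasModelDeriv_orbit q).comp hasModelDeriv_centralExp centralExp_zero

end Action

/-! ## Averaging over central tori -/

section ParametricIntegral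

open MeasureTheory

variable {E : Type*} [NormedAddCommGroup E] [NormedSpace ℝ E]

-- On `[0, 1]` the integral is the convolution at `0` of the indicator of `(0, 1]` with the
-- reflected integrand cut off by a bump function.
theorem contDiffOn_intervalIntegral_param {F : ℝ × E → ℝ} {s : Set E} (hs : IsOpen s)
    (hF : ContDiffOn ℝ ∞ F (univ ×ˢ s)) :
    ContDiffOn ℝ ∞ (fun y ↦ ∫ t in (0 : ℝ)..1, F (t, y)) s := by
  let χ : ContDiffBump (0 : ℝ) := ⟨1, 2, one_pos, one_lt_two⟩
  let f : ℝ → ℝ := indicator (Ioc 0 1) fun _ ↦ 1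
  let g : E → ℝ → ℝ := fun y t ↦ χ (-t) * F (-t, y)
  have hf : LocallyIntegrable f volume :=
    ((integrable_indicator_iff measurableSet_Ioc).2
      (integrableOn_const (by simp))).locallyIntegrable
  have hg : ContDiffOn ℝ ∞ ↿g (s ×ˢ univ) := by
    refine (χ.contDiff.comp contDiff_snd.neg).contDiffOn.mul ?_
    exact hF.comp (contDiff_snd.neg.prodMk contDiff_fst).contDiffOn fun p hp ↦ ⟨trivial, hp.1⟩
  have hgs : ∀ y, ∀ t, y ∈ s → t ∉ Metric.closedBall (0 : ℝ) 2 → g y t = 0 := by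
    intro y t _ ht
    rw [Metric.mem_closedBall, not_le] at ht
    have : χ (-t) = 0 := χ.zero_of_le_dist (by simpa using ht.le)
    simp only [g, this, zero_mul]
  have hconv := (contDiffOn_convolution_right_with_param (μ := volume)
    (ContinuousLinearMap.mul ℝ ℝ) hs (isCompact_closedBall (0 : ℝ) 2) hgs hf hg).comp
    (contDiff_id.prodMk contDiff_const : ContDiff ℝ ∞ fun y : E ↦ (y, (0 : ℝ))).contDiffOn
    fun y hy ↦ ⟨hy, trivial⟩
  refine hconv.congr fun y _ ↦ ?_
  rw [intervalIntegral.integral_of_le zero_le_one, ← integral_indicator measurableSet_Ioc]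
  refine integral_congr_ae (Eventually.of_forall fun t ↦ ?_)
  by_cases ht : t ∈ Ioc (0 : ℝ) 1
  · have : χ t = 1 := χ.one_of_mem_closedBall (by
      rw [mem_closedBall_zero_iff, Real.norm_eq_abs, abs_of_pos ht.1]; exact ht.2)
    simp [f, g, ht, this]
  · simp [f, ht]

theorem contMDiff_intervalIntegral_param {M : Type*} [TopologicalSpace M] [ChartedSpace E M]
    [IsManifold 𝓘(ℝ, E) ∞ M] {F : ℝ × M → ℝ}
    (hF : ContMDiff (𝓘(ℝ, ℝ).prod 𝓘(ℝ, E)) 𝓘(ℝ, ℝ) ∞ F) :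
    ContMDiff 𝓘(ℝ, E) 𝓘(ℝ, ℝ) ∞ (fun x ↦ ∫ t in (0 : ℝ)..1, F (t, x)) := by
  intro x₀
  let χ := chartAt E x₀
  have hchart : ContDiffOn ℝ ∞ (fun p : ℝ × E ↦ F (p.1, χ.symm p.2)) (univ ×ˢ χ.target) := by
    rintro ⟨t, y⟩ ⟨-, hy⟩
    have hsymm : ContMDiffAt 𝓘(ℝ, E) 𝓘(ℝ, E) ∞ χ.symm y :=
      (contMDiffOn_chart_symm (n := ∞)).contMDiffAt (χ.open_target.mem_nhds hy)
    have hsnd : ContMDiffAt 𝓘(ℝ, ℝ × E) 𝓘(ℝ, E) ∞ (fun p : ℝ × E ↦ χ.symm p.2) (t, y) :=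
      ContMDiffAt.comp (t, y) hsymm contDiff_snd.contMDiff.contMDiffAt
    have hfst : ContMDiffAt 𝓘(ℝ, ℝ × E) 𝓘(ℝ, ℝ) ∞ (fun p : ℝ × E ↦ p.1) (t, y) :=
      contDiff_fst.contMDiff.contMDiffAt
    exact (ContMDiffAt.comp (t, y) hF.contMDiffAt
      (hfst.prodMk hsnd)).contDiffAt.contDiffWithinAt
  have hint := (contDiffOn_intervalIntegral_param χ.open_target hchart).contDiffAt
    (χ.open_target.mem_nhds (mem_chart_target E x₀))
  have hχ : ContMDiffAt 𝓘(ℝ, E) 𝓘(ℝ, E) ∞ χ x₀ :=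
    (contMDiffOn_chart (n := ∞)).contMDiffAt (chart_source_mem_nhds E x₀)
  refine (ContMDiffAt.comp x₀ hint.contMDiffAt hχ).congr_of_eventuallyEq ?_
  filter_upwards [chart_source_mem_nhds E x₀] with x hx
  rw [comp_apply, χ.left_inv hx]

end ParametricIntegral

section Average

variable {E : Type*} [NormedAddCommGroup E] [NormedSpace ℝ E]
  {N : Type*} [TopologicalSpace N] [ChartedSpace E N] [Group N]
  [LieGroup 𝓘(ℝ, E) ∞ N] {Γ : Subgroup N}

/-- The central directions along which `φ` is constant. -/
def invariantDirections (φ : N ⧸ Γ → ℝ) : Submodule ℝ (centralLie E N) where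
  carrier := {Y | ∀ (t : ℝ) (q : N ⧸ Γ), φ (centralExp (t • Y) • q) = φ q}
  add_mem' hY hZ t q := by rw [smul_add, centralExp_add_smul, hY, hZ]
  zero_mem' t q := by rw [smul_zero, centralExp_zero, one_smul]
  smul_mem' c Y hY t q := by rw [smul_smul, hY]

theorem mem_invariantDirections {φ : N ⧸ Γ → ℝ} {Y : centralLie E N} :
    Y ∈ invariantDirections φ ↔ ∀ (t : ℝ) (q : N ⧸ Γ), φ (centralExp (t • Y) • q) = φ q :=
  Iff.rfl

/-- The average of `φ` over the segments `{exp (t X) | 0 ≤ t ≤ 1}`; when `exp X ∈ Γ` these are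
the orbits of the one-parameter group generated by `X`. -/
def centralAverage (X : centralLie E N) (φ : N ⧸ Γ → ℝ) (q : N ⧸ Γ) : ℝ :=
  ∫ t in (0 : ℝ)..1, φ (centralExp (t • X) • q)

theorem centralAverage_eq_const {X : centralLie E N} {φ : N ⧸ Γ → ℝ} {q : N ⧸ Γ} {c : ℝ}
    (h : ∀ t : ℝ, φ (centralExp (t • X) • q) = c) : centralAverage X φ q = c := by
  simp [centralAverage, h]

theorem invariantDirections_le_centralAverage (X : centralLie E N) (φ : N ⧸ Γ → ℝ) :
    invariantDirections φ ≤ (invariantDirections (centralAverage X φ) :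
      Submodule ℝ (centralLie E N)) := by
  intro Y hY t q
  simp only [centralAverage, centralExp_smul_comm _ (centralExp (t • Y)), hY t]

theorem mem_invariantDirections_centralAverage {X : centralLie E N} (hX : centralExp X ∈ Γ)
    (φ : N ⧸ Γ → ℝ) : X ∈ invariantDirections (centralAverage X φ) := by
  intro s q
  have hperiodic : Periodic (fun t : ℝ ↦ φ (centralExp (t • X) • q)) 1 := fun t ↦ by
    simp only [add_smul, one_smul, centralExp_add_smul, centralExp_smul_of_mem hX]
  calc centralAverage X φ (centralExp (s • X) • q)
      = ∫ t in (0 : ℝ)..1, φ (centralExp ((t + s) • X) • q) := by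
        simp only [centralAverage, add_smul, centralExp_add_smul]
    _ = ∫ t in s..s + 1, φ (centralExp (t • X) • q) := by
        rw [intervalIntegral.integral_comp_add_right fun t ↦ φ (centralExp (t • X) • q),
          zero_add, add_comm]
    _ = centralAverage X φ q := by
        rw [hperiodic.intervalIntegral_add_eq s 0, zero_add]; rfl

/-- The union of the orbits of points of `K` under the central group with Lie algebra `S`. -/
def centralSaturation (S : Submodule ℝ (centralLie E N)) (K : Set (N ⧸ Γ)) : Set (N ⧸ Γ) :=
  {q | ∃ Y ∈ S, ∃ p ∈ K, centralExp Y • p = q}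

theorem centralExp_smul_mem_centralSaturation {S : Submodule ℝ (centralLie E N)}
    {K : Set (N ⧸ Γ)} {Y : centralLie E N} (hY : Y ∈ S) {q : N ⧸ Γ} (hq : q ∈ K) :
    centralExp Y • q ∈ centralSaturation S K :=
  ⟨Y, hY, q, hq, rfl⟩

theorem exists_mem_box_centralExp_smul_eq {ι : Type*} [Fintype ι] {e : ι → centralLie E N}
    (he : ∀ i, centralExp (e i) ∈ Γ) {Y : centralLie E N} (hY : Y ∈ Submodule.span ℝ (range e))
    (q : N ⧸ Γ) : ∃ c ∈ Icc (0 : ι → ℝ) 1, centralExp (∑ i, c i • e i) • q = centralExp Y • q := by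
  obtain ⟨c, rfl⟩ := (Submodule.mem_span_range_iff_exists_fun ℝ).1 hY
  refine ⟨fun i ↦ Int.fract (c i), ⟨fun i ↦ Int.fract_nonneg _, fun i ↦ (Int.fract_lt_one _).le⟩,
    ?_⟩
  have hfloor : ∑ i, ⌊c i⌋ • e i ∈ Γ.toAddSubgroup.comap (centralExpHom E N) :=
    sum_mem fun i _ ↦ zsmul_mem (AddSubgroup.mem_comap.2 (he i)) _
  have hsum : ∑ i, c i • e i = ∑ i, Int.fract (c i) • e i + ∑ i, ⌊c i⌋ • e i := by
    simp only [← Finset.sum_add_distrib, ← Int.cast_smul_eq_zsmul ℝ, ← add_smul,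
      Int.fract_add_floor]
  rw [hsum, centralExp_add_smul,
    centralExp_smul_of_mem (show centralExp (∑ i, ⌊c i⌋ • e i) ∈ Γ from hfloor)]

variable [FiniteDimensional ℝ E] [DiscreteTopology Γ]

theorem contMDiff_centralAverage (X : centralLie E N) {φ : N ⧸ Γ → ℝ}
    (hφ : ContMDiff 𝓘(ℝ, E) 𝓘(ℝ, ℝ) ∞ φ) :
    ContMDiff 𝓘(ℝ, E) 𝓘(ℝ, ℝ) ∞ (centralAverage X φ) := by
  have hline : ContMDiff 𝓘(ℝ, ℝ) 𝓘(ℝ, centralLie E N) ∞ (fun t : ℝ ↦ t • X) :=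
    ContDiff.contMDiff (by fun_prop)
  exact contMDiff_intervalIntegral_param (F := fun p ↦ φ (centralExp (p.1 • X) • p.2))
    (hφ.comp (contMDiff_centralExp_smul.comp ((hline.comp contMDiff_fst).prodMk contMDiff_snd)))

theorem centralAverage_mem_Icc (X : centralLie E N) {φ : N ⧸ Γ → ℝ} (hφ : Continuous φ)
    (h : ∀ q, φ q ∈ Icc 0 1) (q : N ⧸ Γ) : centralAverage X φ q ∈ Icc 0 1 := by
  have hcont : Continuous (fun t : ℝ ↦ φ (centralExp (t • X) • q)) :=
    hφ.comp ((contMDiff_centralExp_smul (E := E) (Γ := Γ)).continuous.comp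
      (by fun_prop : Continuous fun t : ℝ ↦ (t • X, q)))
  refine ⟨intervalIntegral.integral_nonneg zero_le_one fun t _ ↦ (h _).1, ?_⟩
  calc centralAverage X φ q ≤ ∫ _ in (0 : ℝ)..1, (1 : ℝ) :=
        intervalIntegral.integral_mono_on zero_le_one (hcont.intervalIntegrable _ _) (by simp)
          fun t _ ↦ (h _).2
    _ = 1 := by simp

theorem isCompact_centralSaturation {s : Finset (centralLie E N)}
    (hs : ∀ X ∈ s, centralExp X ∈ Γ) {K : Set (N ⧸ Γ)} (hK : IsCompact K) :
    IsCompact (centralSaturation (Submodule.span ℝ (s : Set (centralLie E N))) K) := by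
  have hcont : Continuous
      (fun p : (s → ℝ) × (N ⧸ Γ) ↦ centralExp (∑ i, p.1 i • (i : centralLie E N)) • p.2) :=
    (contMDiff_centralExp_smul (E := E) (Γ := Γ)).continuous.comp
      (by fun_prop :
        Continuous fun p : (s → ℝ) × (N ⧸ Γ) ↦ (∑ i, p.1 i • (i : centralLie E N), p.2))
  have hrange : (s : Set (centralLie E N)) = range ((↑) : s → centralLie E N) := by simp
  rw [hrange]
  suffices himage : centralSaturation _ K = _ '' Icc (0 : s → ℝ) 1 ×ˢ K from
    himage ▸ (isCompact_Icc.prod hK).image hcont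
  refine Subset.antisymm ?_ ?_
  · rintro _ ⟨Y, hY, p, hp, rfl⟩
    obtain ⟨c, hc, hcY⟩ := exists_mem_box_centralExp_smul_eq (fun i : s ↦ hs i i.2) hY p
    exact ⟨(c, p), ⟨hc, hp⟩, hcY⟩
  · rintro _ ⟨⟨c, p⟩, ⟨-, hp⟩, rfl⟩
    exact ⟨_, (Submodule.mem_span_range_iff_exists_fun ℝ).2 ⟨c, rfl⟩, p, hp, rfl⟩

theorem exists_contMDiff_le_invariantDirections {s : Finset (centralLie E N)}
    (hs : ∀ X ∈ s, centralExp X ∈ Γ) {φ : N ⧸ Γ → ℝ} (hφ : ContMDiff 𝓘(ℝ, E) 𝓘(ℝ, ℝ) ∞ φ)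
    (h01 : ∀ q, φ q ∈ Icc 0 1) :
    ∃ ψ : N ⧸ Γ → ℝ, ContMDiff 𝓘(ℝ, E) 𝓘(ℝ, ℝ) ∞ ψ ∧ (∀ q, ψ q ∈ Icc 0 1) ∧
      Submodule.span ℝ (s : Set (centralLie E N)) ≤ invariantDirections ψ ∧
      ∀ q c, (∀ Y ∈ Submodule.span ℝ (s : Set (centralLie E N)), φ (centralExp Y • q) = c) →
        ψ q = c := by
  classical
  induction s using Finset.induction_on with
  | empty => exact ⟨φ, hφ, h01, by simp, fun q c h ↦ by simpa using h 0 (zero_mem _)⟩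
  | insert X s _ ih =>
    obtain ⟨ψ, hψ, hψ01, hψs, hψc⟩ := ih fun Y hY ↦ hs Y (Finset.mem_insert_of_mem hY)
    refine ⟨centralAverage X ψ, contMDiff_centralAverage X hψ,
      centralAverage_mem_Icc X hψ.continuous hψ01, ?_, fun q c hc ↦ ?_⟩
    · rw [Finset.coe_insert, Submodule.span_insert, sup_le_iff, Submodule.span_singleton_le_iff_mem]
      exact ⟨mem_invariantDirections_centralAverage (hs X (Finset.mem_insert_self X s)) ψ,
        hψs.trans (invariantDirections_le_centralAverage X ψ)⟩
    · refine centralAverage_eq_const fun t ↦ hψc _ c fun Y hY ↦ ?_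
      rw [← centralExp_add_smul]
      refine hc _ (add_mem ?_ (Submodule.smul_mem _ _ (Submodule.subset_span (by simp))))
      exact Submodule.span_mono (by simp) hY

theorem exists_contMDiff_separating_saturations [SigmaCompactSpace (N ⧸ Γ)]
    {t : Set (centralLie E N)} (ht : ∀ X ∈ t, centralExp X ∈ Γ)
    {K₀ K₁ : Set (N ⧸ Γ)} (hK₀ : IsCompact K₀) (hK₁ : IsCompact K₁)
    (hK : Disjoint (centralSaturation (Submodule.span ℝ t) K₀)
      (centralSaturation (Submodule.span ℝ t) K₁)) :
    ∃ φ : N ⧸ Γ → ℝ, ContMDiff 𝓘(ℝ, E) 𝓘(ℝ, ℝ) ∞ φ ∧ (∀ q, φ q ∈ Icc 0 1) ∧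
      Submodule.span ℝ t ≤ invariantDirections φ ∧ EqOn φ 0 K₀ ∧ EqOn φ 1 K₁ := by
  have : T2Space (N ⧸ Γ) := t2Space_quotient E
  obtain ⟨s, hst, hspan⟩ := (Submodule.fg_span_iff_fg_span_finset_subset t).1
    (IsNoetherian.noetherian (Submodule.span ℝ t))
  rw [hspan] at hK ⊢
  have hs : ∀ X ∈ s, centralExp X ∈ Γ := fun X hX ↦ ht X (hst hX)
  obtain ⟨f, hf₀, hf₁, hf⟩ := exists_contMDiffMap_zero_one_of_isClosed (n := (⊤ : ℕ∞)) 𝓘(ℝ, E)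
    (isCompact_centralSaturation hs hK₀).isClosed (isCompact_centralSaturation hs hK₁).isClosed hK
  obtain ⟨φ, hφ, h01, hinv, hconst⟩ := exists_contMDiff_le_invariantDirections hs f.contMDiff hf
  exact ⟨φ, hφ, h01, hinv,
    fun q hq ↦ hconst q 0 fun Y hY ↦ hf₀ (centralExp_smul_mem_centralSaturation hY hq),
    fun q hq ↦ hconst q 1 fun Y hY ↦ hf₁ (centralExp_smul_mem_centralSaturation hY hq)⟩

end Average

/-! ## Perturbations along a central eigenvector -/

section TransferFunction

variable {X : Type*} {f : X → X} {c : ℝ} {ψ : X → ℝ}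

/-- The bounded solution `u` of the twisted cohomological equation `c u = ψ + u ∘ f`, for
`|c| > 1` and bounded `ψ`. -/
def transferFunction (f : X → X) (c : ℝ) (ψ : X → ℝ) (x : X) : ℝ :=
  ∑' k : ℕ, (c ^ (k + 1))⁻¹ * ψ (f^[k] x)

theorem norm_transferFunction_term_le {C : ℝ} (hC : ∀ x, |ψ x| ≤ C) (k : ℕ) (x : X) :
    ‖(c ^ (k + 1))⁻¹ * ψ (f^[k] x)‖ ≤ |c|⁻¹ ^ (k + 1) * C := by
  rw [norm_mul, norm_inv, norm_pow, Real.norm_eq_abs, Real.norm_eq_abs, inv_pow]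
  exact mul_le_mul_of_nonneg_left (hC _) (by positivity)

theorem hasSum_transferFunction_majorant (hc : 1 < |c|) (C : ℝ) :
    HasSum (fun k : ℕ ↦ |c|⁻¹ ^ (k + 1) * C) (C / (|c| - 1)) := by
  have hc0 : |c| ≠ 0 := (one_pos.trans hc).ne'
  have hc1 : |c| - 1 ≠ 0 := (sub_pos.2 hc).ne'
  have hgeom := (hasSum_geometric_of_lt_one (by positivity)
    (inv_lt_one_of_one_lt₀ hc)).mul_left (|c|⁻¹ * C)
  have hlimit : |c|⁻¹ * C * (1 - |c|⁻¹)⁻¹ = C / (|c| - 1) := by field_simp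
  rw [hlimit] at hgeom
  exact hgeom.congr_fun fun k ↦ by ring

theorem abs_transferFunction_le (hc : 1 < |c|) {C : ℝ} (hC : ∀ x, |ψ x| ≤ C) (x : X) :
    |transferFunction f c ψ x| ≤ C / (|c| - 1) :=
  tsum_of_norm_bounded (hasSum_transferFunction_majorant hc C)
    fun k ↦ norm_transferFunction_term_le hC k x

theorem mul_transferFunction (hc : 1 < |c|) {C : ℝ} (hC : ∀ x, |ψ x| ≤ C) (x : X) :
    c * transferFunction f c ψ x = ψ x + transferFunction f c ψ (f x) := by
  have hc0 : c ≠ 0 := abs_pos.1 (one_pos.trans hc)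
  have hsummable : Summable (fun k : ℕ ↦ (c ^ (k + 1))⁻¹ * ψ (f^[k] x)) :=
    .of_norm_bounded (hasSum_transferFunction_majorant hc C).summable
      fun k ↦ norm_transferFunction_term_le hC k x
  rw [transferFunction, hsummable.tsum_eq_zero_add, mul_add, ← tsum_mul_left]
  congr 1
  · rw [zero_add, pow_one, iterate_zero, id_eq, mul_inv_cancel_left₀ hc0]
  · refine tsum_congr fun k ↦ ?_
    rw [iterate_succ_apply, pow_succ' c (k + 1), mul_inv, mul_assoc, mul_inv_cancel_left₀ hc0]

theorem pow_mul_transferFunction (hc : 1 < |c|) {C : ℝ} (hC : ∀ x, |ψ x| ≤ C) {x : X} {n : ℕ}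
    (hzero : ∀ k < n, ψ (f^[k] x) = 0) :
    c ^ n * transferFunction f c ψ x = transferFunction f c ψ (f^[n] x) := by
  induction n with
  | zero => simp
  | succ n ih =>
    rw [pow_succ', mul_assoc, ih fun k hk ↦ hzero k (hk.trans n.lt_succ_self),
      mul_transferFunction hc hC, hzero n n.lt_succ_self, zero_add, iterate_succ_apply']

theorem transferFunction_const_mul (ε : ℝ) (x : X) :
    transferFunction f c (fun x ↦ ε * ψ x) x = ε * transferFunction f c ψ x := by
  simp only [transferFunction, ← tsum_mul_left, mul_left_comm]

theorem transferFunction_ne_zero (hc : 1 < |c|) {K : ℕ} (hK : (|c| - 1)⁻¹ < |c| ^ K) {x : X}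
    (hx : ψ x ≠ 0) (hmax : ∀ y, |ψ y| ≤ |ψ x|) (hzero : ∀ k < K, ψ (f^[k] (f x)) = 0) :
    transferFunction f c ψ x ≠ 0 := by
  intro hux
  have hstep : |ψ x| = |transferFunction f c ψ (f x)| := by
    have hcoh := mul_transferFunction (f := f) hc hmax x
    rw [hux, mul_zero] at hcoh
    rw [eq_neg_of_add_eq_zero_left hcoh.symm, abs_neg]
  have hlower : |c| ^ K * |ψ x| ≤ (|c| - 1)⁻¹ * |ψ x| :=
    calc |c| ^ K * |ψ x| = |transferFunction f c ψ (f^[K] (f x))| := by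
          rw [hstep, ← pow_mul_transferFunction hc hmax hzero, abs_mul, abs_pow]
      _ ≤ |ψ x| / (|c| - 1) := abs_transferFunction_le hc hmax _
      _ = (|c| - 1)⁻¹ * |ψ x| := div_eq_inv_mul _ _
  exact hlower.not_gt (mul_lt_mul_of_pos_right hK (abs_pos.2 hx))

theorem transferFunction_eq_zero_of_isFixedPt {x : X} (hf : IsFixedPt f x) (hψ : ψ x = 0) :
    transferFunction f c ψ x = 0 := by
  simp [transferFunction, iterate_fixed hf, hψ]

theorem continuous_transferFunction [TopologicalSpace X] (hf : Continuous f) (hc : 1 < |c|)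
    {C : ℝ} (hC : ∀ x, |ψ x| ≤ C) (hψ : Continuous ψ) : Continuous (transferFunction f c ψ) :=
  continuous_tsum (fun k ↦ continuous_const.mul (hψ.comp (hf.iterate k)))
    (hasSum_transferFunction_majorant hc C).summable
    fun k x ↦ norm_transferFunction_term_le hC k x

end TransferFunction

section Perturbation

variable {E : Type*} [NormedAddCommGroup E] [NormedSpace ℝ E]

theorem isC1Plus_of_contMDiff {M : Type*} [TopologicalSpace M] [ChartedSpace E M]
    {g : M → M} (hg : ContMDiff 𝓘(ℝ, E) 𝓘(ℝ, E) ∞ g) : IsC1Plus (E := E) g := by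
  refine ⟨hg.of_le (by simp), 1, one_pos, fun x ↦ ?_⟩
  have hchart : ContDiffAt ℝ ∞ (writtenInExtChartAt 𝓘(ℝ, E) 𝓘(ℝ, E) x g)
      (extChartAt 𝓘(ℝ, E) x x) := by
    have hwithin := (contMDiffAt_iff.1 (hg x)).2
    rwa [ModelWithCorners.range_eq_univ, contDiffWithinAt_univ] at hwithin
  obtain ⟨K, s, hs, hK⟩ := (hchart.fderiv_right (m := 1) (by norm_cast)).exists_lipschitzOnWith
  exact ⟨K, s, hs, hK.holderOnWith⟩

variable {N : Type*} [TopologicalSpace N] [ChartedSpace E N] [Group N] [LieGroup 𝓘(ℝ, E) ∞ N]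
  {Γ : Subgroup N} {L : LatticeAut E Γ} {c : ℝ} {ψ : N ⧸ Γ → ℝ} {v : centralLie E N}

theorem contMDiff_quotientEquiv [DiscreteTopology Γ] (L : LatticeAut E Γ) :
    ContMDiff 𝓘(ℝ, E) 𝓘(ℝ, E) ∞ L.quotientEquiv := by
  intro q
  have hlift : ContMDiffAt 𝓘(ℝ, E) 𝓘(ℝ, E) ∞ (fun x : N ↦ (L.toMulEquiv x : N ⧸ Γ))
      (quotientSection (E := E) Γ q q) :=
    ((contMDiff_quotientMk Γ).comp L.contMDiff_toFun).contMDiffAt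
  refine (hlift.comp q (contMDiffAt_quotientSection (E := E) Γ q)).congr_of_eventuallyEq ?_
  filter_upwards [eventually_mk_quotientSection (E := E) q] with z hz
  rw [comp_apply, ← L.quotientEquiv_mk, hz]

theorem iterate_quotientEquiv_centralExp_smul (hv : L.centralMap v = c • v) (k : ℕ) (s : ℝ)
    (q : N ⧸ Γ) : L.quotientEquiv^[k] (centralExp (s • v) • q) =
      centralExp ((c ^ k * s) • v) • L.quotientEquiv^[k] q := by
  induction k with
  | zero => simp
  | succ k ih =>
    rw [iterate_succ_apply', iterate_succ_apply', ih, L.quotientEquiv_centralExp_smul, map_smul, hv,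
      smul_smul, mul_right_comm, ← pow_succ]

theorem quotientEquiv_symm_centralExp_smul (hv : L.centralMap v = c • v) (hc : c ≠ 0) (s : ℝ)
    (q : N ⧸ Γ) : L.quotientEquiv.symm (centralExp (s • v) • q) =
      centralExp ((c⁻¹ * s) • v) • L.quotientEquiv.symm q := by
  rw [Equiv.symm_apply_eq, L.quotientEquiv_centralExp_smul, map_smul, hv, smul_smul,
    Equiv.apply_symm_apply, mul_right_comm, inv_mul_cancel₀ hc, one_mul]

theorem transferFunction_centralExp_smul (hv : L.centralMap v = c • v)
    (hψ : v ∈ invariantDirections ψ) (s : ℝ) (q : N ⧸ Γ) :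
    transferFunction L.quotientEquiv c ψ (centralExp (s • v) • q) =
      transferFunction L.quotientEquiv c ψ q := by
  rw [mem_invariantDirections] at hψ
  simp only [transferFunction, iterate_quotientEquiv_centralExp_smul hv, hψ]

/-- The perturbation `q ↦ exp (ψ q • v) • L q` of the map induced by `L`, a skew translation in
the central direction `v`. -/
def perturb (L : LatticeAut E Γ) (v : centralLie E N) (ψ : N ⧸ Γ → ℝ) (q : N ⧸ Γ) : N ⧸ Γ :=
  centralExp (ψ q • v) • L.quotientEquiv q

/-- The conjugacy `q ↦ exp (u q • v) • q` between `L` and `perturb L v ψ`, where `u` is the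
transfer function of `ψ` and `c` is the eigenvalue of `L` at `v`. -/
def conjMap (L : LatticeAut E Γ) (v : centralLie E N) (c : ℝ) (ψ : N ⧸ Γ → ℝ) (q : N ⧸ Γ) :
    N ⧸ Γ :=
  centralExp (transferFunction L.quotientEquiv c ψ q • v) • q

theorem quotientEquiv_conjMap (hv : L.centralMap v = c • v) (hψ : v ∈ invariantDirections ψ)
    (hc : 1 < |c|) {C : ℝ} (hC : ∀ q, |ψ q| ≤ C) (q : N ⧸ Γ) :
    L.quotientEquiv (conjMap L v c ψ q) = conjMap L v c ψ (perturb L v ψ q) := by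
  rw [conjMap, conjMap, L.quotientEquiv_centralExp_smul, map_smul, hv, smul_smul, perturb,
    transferFunction_centralExp_smul hv hψ, ← centralExp_add_smul, ← add_smul, mul_comm,
    mul_transferFunction hc hC, add_comm]

variable [DiscreteTopology Γ] [FiniteDimensional ℝ E]

theorem contMDiff_centralExp_smul_smul {F : Type*} [NormedAddCommGroup F] [NormedSpace ℝ F]
    {H : Type*} [TopologicalSpace H] {J : ModelWithCorners ℝ F H} {P : Type*} [TopologicalSpace P]
    [ChartedSpace H P] {n : ℕ∞ω} (hn : n ≤ ∞) {a : P → ℝ} {f : P → N ⧸ Γ}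
    (ha : ContMDiff J 𝓘(ℝ, ℝ) n a) (hf : ContMDiff J 𝓘(ℝ, E) n f) (v : centralLie E N) :
    ContMDiff J 𝓘(ℝ, E) n (fun q ↦ centralExp (a q • v) • f q) := by
  have hline : ContMDiff 𝓘(ℝ, ℝ) 𝓘(ℝ, centralLie E N) n (fun t : ℝ ↦ t • v) :=
    ContDiff.contMDiff (by fun_prop)
  exact (contMDiff_centralExp_smul.of_le hn).comp ((hline.comp ha).prodMk hf)

theorem continuous_centralExp_smul_smul {P : Type*} [TopologicalSpace P] {a : P → ℝ}
    {f : P → N ⧸ Γ} (ha : Continuous a) (hf : Continuous f) (v : centralLie E N) :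
    Continuous (fun q ↦ centralExp (a q • v) • f q) :=
  (contMDiff_centralExp_smul (E := E) (Γ := Γ)).continuous.comp
    ((ha.smul continuous_const).prodMk hf)

/-- `conjMap` along an expanding eigenvector, as a homeomorphism. -/
def conjHomeo (hv : L.centralMap v = c • v) (hψ : v ∈ invariantDirections ψ) (hc : 1 < |c|)
    {C : ℝ} (hC : ∀ q, |ψ q| ≤ C) (hcont : Continuous ψ) : (N ⧸ Γ) ≃ₜ (N ⧸ Γ) where
  toFun := conjMap L v c ψ
  invFun q := centralExp (-transferFunction L.quotientEquiv c ψ q • v) • q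
  left_inv q := by
    simp only [conjMap, transferFunction_centralExp_smul hv hψ, ← centralExp_add_smul, ← add_smul,
      neg_add_cancel, zero_smul, centralExp_zero, one_smul]
  right_inv q := by
    simp only [conjMap, transferFunction_centralExp_smul hv hψ, ← centralExp_add_smul, ← add_smul,
      add_neg_cancel, zero_smul, centralExp_zero, one_smul]
  continuous_toFun := continuous_centralExp_smul_smul
    (continuous_transferFunction (contMDiff_quotientEquiv L).continuous hc hC hcont)
    continuous_id v
  continuous_invFun := continuous_centralExp_smul_smul
    (continuous_transferFunction (contMDiff_quotientEquiv L).continuous hc hC hcont).neg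
    continuous_id v

theorem contMDiff_perturb (hψ : ContMDiff 𝓘(ℝ, E) 𝓘(ℝ, ℝ) ∞ ψ) :
    ContMDiff 𝓘(ℝ, E) 𝓘(ℝ, E) ∞ (perturb L v ψ) :=
  contMDiff_centralExp_smul_smul le_rfl hψ (contMDiff_quotientEquiv L) v

/-- `perturb` along an eigenvector, as a diffeomorphism. -/
def perturbDiffeo (hv : L.centralMap v = c • v) (hc : c ≠ 0) (hψ : v ∈ invariantDirections ψ)
    (hsmooth : ContMDiff 𝓘(ℝ, E) 𝓘(ℝ, ℝ) ∞ ψ) :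
    (N ⧸ Γ) ≃ₘ^1⟮𝓘(ℝ, E), 𝓘(ℝ, E)⟯ (N ⧸ Γ) where
  toFun := perturb L v ψ
  invFun q := L.quotientEquiv.symm (centralExp (-ψ (L.quotientEquiv.symm q) • v) • q)
  left_inv q := by
    rw [mem_invariantDirections] at hψ
    simp only [perturb, quotientEquiv_symm_centralExp_smul hv hc, Equiv.symm_apply_apply, hψ,
      ← centralExp_add_smul, ← add_smul, neg_add_cancel, zero_smul, centralExp_zero, one_smul]
  right_inv q := by
    rw [mem_invariantDirections] at hψ
    simp only [perturb]
    rw [Equiv.apply_symm_apply, quotientEquiv_symm_centralExp_smul hv hc, hψ,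
      ← centralExp_add_smul, ← add_smul, add_neg_cancel, zero_smul, centralExp_zero, one_smul]
  contMDiff_toFun := (contMDiff_perturb hsmooth).of_le (by simp)
  contMDiff_invFun := by
    have hL : ContMDiff 𝓘(ℝ, E) 𝓘(ℝ, E) 1 L.quotientEquiv.symm := L.quotientDiffeo.symm.contMDiff
    exact hL.comp (contMDiff_centralExp_smul_smul (by simp)
      ((hsmooth.of_le (by simp)).comp hL).neg contMDiff_id v)

end Perturbation

/-! ## Convergence in the `C^1` topology -/

section C1Topology

open Bundle

variable {E : Type*} [NormedAddCommGroup E] [NormedSpace ℝ E]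
  {M : Type*} [TopologicalSpace M] [ChartedSpace E M] [IsManifold 𝓘(ℝ, E) ∞ M]

theorem continuous_tangentMap_param {G : ℝ × M → M}
    (hG : ContMDiff (𝓘(ℝ, ℝ).prod 𝓘(ℝ, E)) 𝓘(ℝ, E) ∞ G) :
    Continuous (fun p : ℝ × TangentBundle 𝓘(ℝ, E) M ↦
      tangentMap 𝓘(ℝ, E) 𝓘(ℝ, E) (fun q ↦ G (p.1, q)) p.2) := by
  have htangent : Continuous (tangentMap (𝓘(ℝ, ℝ).prod 𝓘(ℝ, E)) 𝓘(ℝ, E) G) :=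
    hG.continuous_tangentMap (by simp)
  have hprod : Continuous (equivTangentBundleProd 𝓘(ℝ, ℝ) ℝ 𝓘(ℝ, E) M).symm :=
    (contMDiff_equivTangentBundleProd_symm (I := 𝓘(ℝ, ℝ)) (M := ℝ) (I' := 𝓘(ℝ, E)) (M' := M)
      (n := 0)).continuous
  have hzero : Continuous (fun t : ℝ ↦ (⟨t, 0⟩ : TangentBundle 𝓘(ℝ, ℝ) ℝ)) :=
    (contMDiff_zeroSection (IB := 𝓘(ℝ, ℝ)) ℝ
      (TangentSpace 𝓘(ℝ, ℝ) : ℝ → Type _) (n := 0)).continuous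
  refine (htangent.comp (hprod.comp
    ((hzero.comp continuous_fst).prodMk continuous_snd))).congr fun p ↦ ?_
  have hslice : MDifferentiableAt 𝓘(ℝ, E) (𝓘(ℝ, ℝ).prod 𝓘(ℝ, E)) (fun q : M ↦ (p.1, q)) p.2.1 :=
    mdifferentiableAt_const.prodMk mdifferentiableAt_id
  have hcomp := tangentMap_comp_at p.2 (hG.mdifferentiableAt (by simp)) hslice
  rw [show (fun q : M ↦ G (p.1, q)) = G ∘ fun q : M ↦ (p.1, q) from rfl, hcomp,
    tangentMap_prod_right]
  rfl

theorem tendsto_c1Topology {g : ℝ → M ≃ₘ^1⟮𝓘(ℝ, E), 𝓘(ℝ, E)⟯ M}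
    (hG : ContMDiff (𝓘(ℝ, ℝ).prod 𝓘(ℝ, E)) 𝓘(ℝ, E) ∞ (fun p : ℝ × M ↦ g p.1 p.2)) (t₀ : ℝ) :
    Tendsto g (𝓝 t₀) (@nhds _ (c1Topology (E := E) (M := M)) (g t₀)) := by
  rw [nhds_induced, tendsto_comap_iff]
  refine Continuous.tendsto (f := _ ∘ g) ?_ t₀
  exact ContinuousMap.continuous_of_continuous_uncurry _ (continuous_tangentMap_param hG)

end C1Topology

/-! ## Periodic data of the perturbation -/

section PeriodicData

open Module

theorem add_smulRight_mul_pow_add_smulRight {K V : Type*} [Field K] [AddCommGroup V] [Module K V]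
    {A : End K V} {c : K} {v : V} (hv : A.HasEigenvector c v) {ℓ m : V →ₗ[K] K} (hm : m v = 0)
    (n : ℕ) : (A + m.smulRight v) * (A ^ n + ℓ.smulRight v) =
      A ^ (n + 1) + (c • ℓ + m ∘ₗ A ^ n).smulRight v := by
  refine LinearMap.ext fun x ↦ ?_
  simp only [LinearMap.add_apply, LinearMap.smulRight_apply, LinearMap.smul_apply,
    End.mul_apply, map_add, map_smul, hm, hv.apply_eq_smul, pow_succ', LinearMap.comp_apply]
  module

variable {E : Type*} [NormedAddCommGroup E] [NormedSpace ℝ E] [FiniteDimensional ℝ E]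
  {N : Type*} [TopologicalSpace N] [ChartedSpace E N] [Group N]
  [LieGroup 𝓘(ℝ, E) ∞ N] {Γ : Subgroup N} [DiscreteTopology Γ]

/-- In the frames of the tangent spaces given by the orbit maps of `N`, the derivative of `g` at
`q` is `A`. -/
def HasFrameDeriv (g : N ⧸ Γ → N ⧸ Γ) (q : N ⧸ Γ) (A : E →ₗ[ℝ] E) : Prop :=
  ∃ D : E →L[ℝ] E, HasModelDeriv g q D ∧
    ∀ X, D (orbitDeriv (E := E) q X) = orbitDeriv (E := E) (g q) (A X)

theorem HasFrameDeriv.comp {f g : N ⧸ Γ → N ⧸ Γ} {q : N ⧸ Γ} {A B : E →ₗ[ℝ] E}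
    (hf : HasFrameDeriv f (g q) A) (hg : HasFrameDeriv g q B) :
    HasFrameDeriv (f ∘ g) q (A * B) := by
  obtain ⟨C, hC, hCA⟩ := hf
  obtain ⟨D, hD, hDB⟩ := hg
  refine ⟨C.comp D, hC.comp hD rfl, fun X ↦ ?_⟩
  rw [ContinuousLinearMap.comp_apply, hDB, hCA, End.mul_apply, comp_apply]

theorem HasFrameDeriv.exists_conj_mfderiv {f g : N ⧸ Γ → N ⧸ Γ} {p q : N ⧸ Γ} {A B : E →ₗ[ℝ] E}
    (hf : HasFrameDeriv f q A) (hfq : f q = q) (hg : HasFrameDeriv g p B) (hgp : g p = p)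
    {P : E ≃ₗ[ℝ] E} (hP : ∀ X, P (B X) = A (P X)) :
    ∃ Q : TangentSpace 𝓘(ℝ, E) p ≃L[ℝ] TangentSpace 𝓘(ℝ, E) q, ∀ X : E,
      Q (mfderiv 𝓘(ℝ, E) 𝓘(ℝ, E) g p X) = mfderiv 𝓘(ℝ, E) 𝓘(ℝ, E) f q (Q X) := by
  obtain ⟨C, hC, hCA⟩ := hf
  obtain ⟨D, hD, hDB⟩ := hg
  rw [hfq] at hCA
  rw [hgp] at hDB
  have hconj (X : E) : orbitDeriv (E := E) q (P ((orbitDeriv (E := E) p).symm (D X))) =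
      C (orbitDeriv (E := E) q (P ((orbitDeriv (E := E) p).symm X))) := by
    obtain ⟨Y, rfl⟩ := (orbitDeriv (E := E) p).surjective X
    rw [hDB, ContinuousLinearEquiv.symm_apply_apply, ContinuousLinearEquiv.symm_apply_apply, hCA,
      hP]
  rw [← hD.modelDeriv_eq, ← hC.modelDeriv_eq] at hconj
  exact ⟨((orbitDeriv (E := E) p).symm.trans P.toContinuousLinearEquiv).trans
    (orbitDeriv (E := E) q), hconj⟩

theorem hasFrameDeriv_id (q : N ⧸ Γ) : HasFrameDeriv id q (1 : E →ₗ[ℝ] E) :=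
  ⟨_, hasModelDeriv_id q, fun _ ↦ rfl⟩

theorem hasFrameDeriv_of_smul {g : N ⧸ Γ → N ⧸ Γ} (hg : ContMDiff 𝓘(ℝ, E) 𝓘(ℝ, E) ∞ g)
    {q : N ⧸ Γ} {β : N → N} {A : E →L[ℝ] E} (hβ : HasModelDeriv β 1 A) (hβ1 : β 1 = 1)
    (h : ∀ y, g (y • q) = β y • g q) : HasFrameDeriv g q (A : E →ₗ[ℝ] E) := by
  have hgq := hasModelDeriv_of_contMDiffAt (hg q) (by simp)
  refine ⟨_, hgq, fun X ↦ ?_⟩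
  have hleft := hgq.comp (hasModelDeriv_orbit (E := E) q) (one_smul N q)
  have hright := (hasModelDeriv_orbit (E := E) (g q)).comp hβ hβ1
  simp only [h] at hleft
  exact congrArg (fun C : E →L[ℝ] E ↦ C X) (hleft.unique hright)

theorem hasFrameDeriv_quotientEquiv (L : LatticeAut E Γ) (q : N ⧸ Γ) :
    HasFrameDeriv L.quotientEquiv q (L.modelDifferential : E →ₗ[ℝ] E) :=
  hasFrameDeriv_of_smul (contMDiff_quotientEquiv L) L.hasModelDeriv (map_one _)
    fun y ↦ L.quotientEquiv_smul y q

theorem hasFrameDeriv_iterate_quotientEquiv (L : LatticeAut E Γ) (n : ℕ) (q : N ⧸ Γ) :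
    HasFrameDeriv L.quotientEquiv^[n] q ((L.modelDifferential : E →ₗ[ℝ] E) ^ n) := by
  induction n with
  | zero => exact hasFrameDeriv_id q
  | succ n ih =>
    rw [pow_succ', iterate_succ']
    exact (hasFrameDeriv_quotientEquiv L _).comp ih

variable {L : LatticeAut E Γ} {v : centralLie E N} {c : ℝ} {ψ : N ⧸ Γ → ℝ}

theorem modelDeriv_orbitDeriv_eq_zero (hψ : v ∈ invariantDirections ψ)
    (hsmooth : ContMDiff 𝓘(ℝ, E) 𝓘(ℝ, ℝ) ∞ ψ) (q : N ⧸ Γ) :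
    (modelDeriv ψ q : E →L[ℝ] ℝ) (orbitDeriv (E := E) q v) = 0 := by
  have horbit := (hasModelDeriv_of_contMDiffAt (hsmooth q) (by simp)).comp
    ((hasModelDeriv_orbit (E := E) q).comp (isCentralFlow_centralExp v).hasModelDeriv (by simp))
    (by simp)
  rw [mem_invariantDirections] at hψ
  simp only [hψ] at horbit
  have hconst : HasModelDeriv (fun _ : ℝ ↦ ψ q) (0 : ℝ) (0 : ℝ →L[ℝ] ℝ) :=
    hasModelDeriv_iff_hasFDerivAt.2 (hasFDerivAt_const _ _)
  rw [← ContinuousLinearEquiv.coe_coe, coe_orbitDeriv]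
  simpa using congrArg (fun C : ℝ →L[ℝ] ℝ ↦ C 1) (horbit.unique hconst)

theorem hasFrameDeriv_perturb (hψ : v ∈ invariantDirections ψ)
    (hsmooth : ContMDiff 𝓘(ℝ, E) 𝓘(ℝ, ℝ) ∞ ψ) (q : N ⧸ Γ) :
    ∃ ℓ : E →ₗ[ℝ] ℝ, ℓ v = 0 ∧ HasFrameDeriv (perturb L v ψ) q
      ((L.modelDifferential : E →ₗ[ℝ] E) + ℓ.smulRight (v : E)) := by
  set ℓ : E →L[ℝ] ℝ := (modelDeriv ψ q : E →L[ℝ] ℝ).comp (orbitDeriv (E := E) q : E →L[ℝ] E)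
    with hℓ
  refine ⟨ℓ, modelDeriv_orbitDeriv_eq_zero hψ hsmooth q, ?_⟩
  have hψorbit : HasModelDeriv (fun y : N ↦ ψ (y • q)) 1 ℓ := by
    rw [hℓ, coe_orbitDeriv]
    exact (hasModelDeriv_of_contMDiffAt (hsmooth q) (by simp)).comp (hasModelDeriv_orbit q)
      (one_smul N q)
  have hshift : HasModelDeriv (fun t : ℝ ↦ t - ψ q) (ψ q) (ContinuousLinearMap.id ℝ ℝ) :=
    hasModelDeriv_iff_hasFDerivAt.2 ((hasFDerivAt_id _).sub_const _)
  have htranslation := ((isCentralFlow_centralExp v).hasModelDeriv.comp hshift (sub_self _)).comp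
    hψorbit (by rw [one_smul])
  have hlift := L.hasModelDeriv.mul_of_eq_one htranslation (map_one _) (by simp)
  convert hasFrameDeriv_of_smul (contMDiff_perturb (L := L) (v := v) hsmooth) hlift (by simp)
    fun y ↦ ?_ using 1
  · ext X
    simp
  · rw [perturb, perturb, L.quotientEquiv_smul, ← centralExp_mul_comm, mul_smul,
      ← centralExp_smul_comm, ← centralExp_add_smul, ← add_smul, sub_add_cancel]

theorem hasFrameDeriv_iterate_perturb
    (hv : End.HasEigenvector (L.modelDifferential : E →ₗ[ℝ] E) c v)
    (hψ : v ∈ invariantDirections ψ) (hsmooth : ContMDiff 𝓘(ℝ, E) 𝓘(ℝ, ℝ) ∞ ψ) (n : ℕ)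
    (q : N ⧸ Γ) :
    ∃ ℓ : E →ₗ[ℝ] ℝ, ℓ v = 0 ∧ HasFrameDeriv (perturb L v ψ)^[n] q
      ((L.modelDifferential : E →ₗ[ℝ] E) ^ n + ℓ.smulRight (v : E)) := by
  induction n with
  | zero =>
    refine ⟨0, rfl, ?_⟩
    rw [pow_zero, LinearMap.zero_smulRight, add_zero]
    exact hasFrameDeriv_id q
  | succ n ih =>
    obtain ⟨ℓ, hℓ, hn⟩ := ih
    obtain ⟨m, hm, hperturb⟩ := hasFrameDeriv_perturb (L := L) hψ hsmooth ((perturb L v ψ)^[n] q)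
    refine ⟨c • ℓ + m ∘ₗ (L.modelDifferential : E →ₗ[ℝ] E) ^ n, ?_, ?_⟩
    · simp [hℓ, hv.pow_apply, hm]
    · rw [iterate_succ', ← add_smulRight_mul_pow_add_smulRight hv hm]
      exact hperturb.comp hn

theorem samePeriodicData_perturb {ι : Type*} {b : Basis ι ℝ E} {l : ι → ℝ}
    (hb : ∀ i, End.HasEigenvector (L.modelDifferential : E →ₗ[ℝ] E) (l i) (b i))
    (hl : Injective (fun i ↦ |l i|)) {i : ι} (hvi : (v : E) = b i)
    (hψ : v ∈ invariantDirections ψ) (hsmooth : ContMDiff 𝓘(ℝ, E) 𝓘(ℝ, ℝ) ∞ ψ)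
    {h : N ⧸ Γ → N ⧸ Γ} (hconj : ∀ q, L.quotientEquiv (h q) = h (perturb L v ψ q)) :
    SamePeriodicData (E := E) L.quotientEquiv (perturb L v ψ) h := by
  intro p n hn hp
  obtain ⟨ℓ, hℓ, hderiv⟩ := hasFrameDeriv_iterate_perturb (hvi ▸ hb i) hψ hsmooth n p
  obtain ⟨P, hP⟩ := exists_conj_add_smul_basis (A := (L.modelDifferential : E →ₗ[ℝ] E) ^ n)
    (l := fun i ↦ l i ^ n)
    (fun i ↦ ⟨End.mem_eigenspace_iff.2 ((hb i).pow_apply n), (hb i).2⟩)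
    (fun j hj h ↦ hj (hl ((pow_left_inj₀ (abs_nonneg _) (abs_nonneg _) hn.ne').1
      (by simpa only [← abs_pow] using congrArg abs h)))) (hvi ▸ hℓ)
  exact (hasFrameDeriv_iterate_quotientEquiv L n (h p)).exists_conj_mfderiv
    (hp.map fun q ↦ (hconj q).symm) hderiv hp (P := P) fun X ↦ by
      rw [LinearMap.add_apply, LinearMap.smulRight_apply, hvi, hP]

end PeriodicData

/-! ## Non-differentiability of the conjugacy -/

section NotDifferentiable

open Asymptotics

theorem eq_zero_of_isBigO_id_of_geometric {F : ℝ → ℝ} {c d t₀ : ℝ} (hc : c ≠ 0)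
    (hcd : |c| < |d|) (hd : 1 < |d|) (hF : F =O[𝓝 0] (fun s ↦ s))
    (hgeom : ∀ k : ℕ, F ((d ^ k)⁻¹ * t₀) = (c ^ k)⁻¹ * F t₀) : F t₀ = 0 := by
  have hlim : Tendsto (fun k : ℕ ↦ d⁻¹ ^ k * t₀) atTop (𝓝 0) := by
    have hd' : |d⁻¹| < 1 := by rw [abs_inv]; exact inv_lt_one_of_one_lt₀ hd
    simpa only [zero_mul] using (tendsto_pow_atTop_nhds_zero_of_abs_lt_one hd').mul_const t₀
  have hlittle : (fun k : ℕ ↦ d⁻¹ ^ k) =o[atTop] fun k ↦ c⁻¹ ^ k := by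
    refine isLittleO_pow_pow_of_abs_lt_left ?_
    rw [abs_inv, abs_inv]
    exact inv_strictAnti₀ (abs_pos.2 hc) hcd
  have hbig : (fun k : ℕ ↦ F t₀ * c⁻¹ ^ k) =O[atTop] fun k ↦ t₀ * d⁻¹ ^ k := by
    refine (hF.comp_tendsto hlim).congr (fun k ↦ ?_) fun k ↦ ?_
    · rw [comp_apply, inv_pow, inv_pow, hgeom, mul_comm]
    · rw [comp_apply, mul_comm]
  by_contra hne
  have hpow : (fun k : ℕ ↦ c⁻¹ ^ k) =o[atTop] fun k ↦ c⁻¹ ^ k :=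
    ((isBigO_self_const_mul hne _ _).trans hbig).trans_isLittleO (hlittle.const_mul_left t₀)
  exact isLittleO_irrefl (Frequently.of_forall fun k ↦ pow_ne_zero k (inv_ne_zero hc)) hpow

variable {E : Type*} [NormedAddCommGroup E] [NormedSpace ℝ E]
  {N : Type*} [TopologicalSpace N] [ChartedSpace E N] [Group N] [LieGroup 𝓘(ℝ, E) ∞ N]
  {Γ : Subgroup N} {v w : centralLie E N}

theorem pow_inv_mul_transferFunction_centralExp_smul {L : LatticeAut E Γ} {c d : ℝ}
    (hw : L.centralMap w = d • w) (hc : 1 < |c|) (hd : d ≠ 0) {ψ : N ⧸ Γ → ℝ} {C : ℝ}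
    (hC : ∀ q, |ψ q| ≤ C) {o : N ⧸ Γ} (ho : IsFixedPt L.quotientEquiv o) {t₀ : ℝ}
    (hψ : ∀ k : ℕ, ψ (centralExp (((d ^ (k + 1))⁻¹ * t₀) • w) • o) = 0) (k : ℕ) :
    transferFunction L.quotientEquiv c ψ (centralExp (((d ^ k)⁻¹ * t₀) • w) • o) =
      (c ^ k)⁻¹ * transferFunction L.quotientEquiv c ψ (centralExp (t₀ • w) • o) := by
  have horbit : ∀ m, L.quotientEquiv^[m] (centralExp (((d ^ k)⁻¹ * t₀) • w) • o) =
      centralExp ((d ^ m * ((d ^ k)⁻¹ * t₀)) • w) • o := fun m ↦ by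
    rw [iterate_quotientEquiv_centralExp_smul hw, (ho.iterate m).eq]
  have hc0 : c ≠ 0 := abs_pos.1 (one_pos.trans hc)
  rw [eq_inv_mul_iff_mul_eq₀ (pow_ne_zero k hc0), pow_mul_transferFunction hc hC fun m hm ↦ ?_,
    horbit, mul_inv_cancel_left₀ (pow_ne_zero k hd)]
  obtain ⟨n, rfl⟩ := Nat.exists_eq_add_of_lt hm
  rw [horbit, ← hψ n, ← mul_assoc, add_assoc, pow_add d m, mul_inv,
    mul_inv_cancel_left₀ (pow_ne_zero m hd)]

variable [FiniteDimensional ℝ E] [DiscreteTopology Γ]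

theorem isBigO_of_hasModelDeriv_centralExp_smul {u : N ⧸ Γ → ℝ} {q : N ⧸ Γ} {A : E →L[ℝ] E}
    (hA : HasModelDeriv (fun x ↦ centralExp (u x • v) • x) q A) (hv : v ≠ 0)
    (hu : ContinuousAt u q) (huq : u q = 0) (w : centralLie E N) :
    (fun s : ℝ ↦ u (centralExp (s • w) • q)) =O[𝓝 0] fun s ↦ s := by
  set F : ℝ → ℝ := fun s ↦ u (centralExp (s • w) • q)
  have hline : HasModelDeriv (fun s : ℝ ↦ centralExp (s • w) • q) 0 _ :=
    (hasModelDeriv_centralExp_smul q).comp (hasModelDeriv_iff_hasFDerivAt.2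
      (ContinuousLinearMap.toSpanSingleton ℝ w).hasFDerivAt) (zero_smul ℝ w)
  have hline_zero : centralExp ((0 : ℝ) • w) • q = q := by simp
  have hX : Tendsto (fun s : ℝ ↦ F s • v + s • w) (𝓝 0) (𝓝 0) := by
    have hF : Tendsto F (𝓝 0) (𝓝 0) := by
      have := hu.tendsto.comp (hline_zero ▸ hline.continuousAt.tendsto)
      rwa [huq] at this
    simpa only [zero_smul, add_zero, id] using (hF.smul_const v).add (tendsto_id.smul_const w)
  have hlog : (fun s : ℝ ↦ F s • v + s • w) =O[𝓝 0]
      fun s ↦ chartAt E q (centralExp (F s • v + s • w) • q) - chartAt E q q := by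
    have := (hasModelDeriv_centralExp_smul (E := E) q).isBigO_sub_rev
      ((orbitDeriv (E := E) q).injective.comp Subtype.val_injective)
    simp only [centralExp_zero, one_smul, sub_zero] at this
    exact this.comp_tendsto hX
  have hchart : (fun s ↦ chartAt E q (centralExp (F s • v + s • w) • q) - chartAt E q q) =O[𝓝 0]
      fun s ↦ s := by
    have := (hA.comp hline hline_zero).hasFDerivAt_chartAt.isBigO_sub
    simpa only [hline_zero, huq, zero_smul, centralExp_zero, one_smul, sub_zero,
      ← centralExp_add_smul] using this
  have hw : (fun s : ℝ ↦ s • w) =O[𝓝 0] fun s ↦ s :=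
    .of_bound ‖w‖ (Eventually.of_forall fun s ↦ by rw [norm_smul, mul_comm])
  have hFv : (fun s ↦ F s • v) =O[𝓝 0] fun s ↦ s :=
    ((hlog.trans hchart).sub hw).congr_left fun s ↦ add_sub_cancel_right _ _
  refine IsBigO.trans (.of_bound ‖v‖⁻¹ (Eventually.of_forall fun s ↦ ?_)) hFv
  rw [norm_smul, mul_comm, mul_inv_cancel_right₀ (norm_ne_zero_iff.2 hv)]

theorem not_hasModelDeriv_conjMap {L : LatticeAut E Γ} {c d : ℝ} (hw : L.centralMap w = d • w)
    (hc : 1 < |c|) (hcd : |c| < |d|) (hv : v ≠ 0) {ψ : N ⧸ Γ → ℝ} {C : ℝ}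
    (hC : ∀ q, |ψ q| ≤ C) (hcont : Continuous ψ) {o : N ⧸ Γ} (ho : IsFixedPt L.quotientEquiv o)
    (hψo : ψ o = 0) {t₀ : ℝ} (hψ : ∀ k : ℕ, ψ (centralExp (((d ^ (k + 1))⁻¹ * t₀) • w) • o) = 0)
    (ht₀ : transferFunction L.quotientEquiv c ψ (centralExp (t₀ • w) • o) ≠ 0) (A : E →L[ℝ] E) :
    ¬ HasModelDeriv (conjMap L v c ψ) o A := by
  intro hA
  have hd := hc.trans hcd
  have hu : Continuous (transferFunction L.quotientEquiv c ψ) :=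
    continuous_transferFunction (contMDiff_quotientEquiv L).continuous hc hC hcont
  exact ht₀ (eq_zero_of_isBigO_id_of_geometric (abs_pos.1 (one_pos.trans hc)) hcd hd
    (isBigO_of_hasModelDeriv_centralExp_smul hA hv hu.continuousAt
      (transferFunction_eq_zero_of_isFixedPt ho hψo) w)
    (pow_inv_mul_transferFunction_centralExp_smul hw hc (abs_pos.1 (one_pos.trans hd)) hC ho hψ))

end NotDifferentiable

/-! ## The choice of the perturbation -/

section Choice

theorem exists_notMem_countable_of_one_lt_abs {T : Set ℝ} (hT : T.Countable) {d : ℝ}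
    (hd : 1 < |d|) : ∃ t, t ∉ T ∧ ∀ m : ℤ, m ≠ 0 → t - d ^ m * t ∉ T := by
  have hpow : ∀ m : ℤ, m ≠ 0 → 1 - d ^ m ≠ 0 := fun m hm h ↦ by
    have habs : |d| ^ m = 1 := by rw [← abs_zpow, ← sub_eq_zero.1 h, abs_one]
    exact hm ((zpow_eq_one_iff_right₀ (abs_nonneg d) hd.ne').1 habs)
  have hbad : (T ∪ ⋃ m : {m : ℤ // m ≠ 0}, (fun t ↦ (1 - d ^ (m : ℤ)) * t) ⁻¹' T).Countable :=
    hT.union (countable_iUnion fun m ↦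
      hT.preimage_of_injOn (mul_right_injective₀ (hpow m m.2)).injOn)
  obtain ⟨t, ht⟩ := (hbad.dense_compl ℝ).nonempty
  simp only [mem_compl_iff, mem_union, mem_iUnion, not_or, not_exists, mem_preimage, sub_mul,
    one_mul] at ht
  exact ⟨t, ht.1, fun m hm ↦ ht.2 ⟨m, hm⟩⟩

variable {E : Type*} [NormedAddCommGroup E] [NormedSpace ℝ E]
  {N : Type*} [TopologicalSpace N] [ChartedSpace E N] [Group N] [LieGroup 𝓘(ℝ, E) ∞ N]
  {Γ : Subgroup N} {S : Submodule ℝ (centralLie E N)} {w : centralLie E N}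

theorem centralExp_sub_mem_of_smul_eq {X Y : centralLie E N} {q : N ⧸ Γ}
    (h : centralExp X • q = centralExp Y • q) : centralExp (X - Y) ∈ Γ := by
  obtain ⟨x, rfl⟩ := QuotientGroup.mk_surjective q
  rw [MulAction.Quotient.smul_mk, MulAction.Quotient.smul_mk, smul_eq_mul, smul_eq_mul] at h
  have hmem := QuotientGroup.eq.1 h.symm
  rwa [mul_inv_rev, ← centralExp_neg, mul_assoc, ← mul_assoc (centralExp (-Y)), ← centralExp_add,
    centralExp_mul_comm, inv_mul_cancel_left, neg_add_eq_sub] at hmem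

/-- The times at which the flow `q ↦ exp (r • w) • q` on `N ⧸ Γ` maps an orbit of the central
group `exp S` to itself. By centrality they do not depend on the orbit. -/
def returnTimes (Γ : Subgroup N) (S : Submodule ℝ (centralLie E N)) (w : centralLie E N) : Set ℝ :=
  {r | ∃ Y ∈ S, centralExp (r • w - Y) ∈ Γ}

theorem sub_mem_returnTimes {s t : ℝ} {q x : N ⧸ Γ}
    (hs : x ∈ centralSaturation S {centralExp (s • w) • q})
    (ht : x ∈ centralSaturation S {centralExp (t • w) • q}) : t - s ∈ returnTimes Γ S w := by
  obtain ⟨Y, hY, _, rfl, rfl⟩ := hs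
  obtain ⟨Z, hZ, _, rfl, hZx⟩ := ht
  rw [← centralExp_add_smul, ← centralExp_add_smul] at hZx
  refine ⟨Y - Z, sub_mem hY hZ, ?_⟩
  convert centralExp_sub_mem_of_smul_eq hZx using 2
  rw [sub_smul]
  abel

variable [FiniteDimensional ℝ E] [DiscreteTopology Γ]

theorem countable_returnTimes (hw : w ∉ S) : (returnTimes Γ S w).Countable := by
  have : Countable (centralLattice E Γ) :=
    TopologicalSpace.separableSpace_iff_countable.1 inferInstance
  choose Y hYS hYΓ using fun r : returnTimes Γ S w ↦ r.2
  refine countable_coe_iff.1 (Injective.countable (f := fun r : returnTimes Γ S w ↦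
    (⟨((r : ℝ) • w - Y r : centralLie E N), coe_mem_centralLattice.2 (hYΓ r)⟩ :
      centralLattice E Γ)) fun r s hrs ↦ ?_)
  have heq : (r : ℝ) • w - Y r = (s : ℝ) • w - Y s :=
    Subtype.ext (congrArg (fun X : centralLattice E Γ ↦ (X : E)) hrs)
  have hmem : ((r : ℝ) - s) • w ∈ S := by
    rw [sub_smul, sub_eq_sub_iff_sub_eq_sub.1 heq]
    exact sub_mem (hYS r) (hYS s)
  by_contra hne
  exact hw ((S.smul_mem_iff (sub_ne_zero.2 fun h ↦ hne (Subtype.ext h))).1 hmem)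

variable [SigmaCompactSpace (N ⧸ Γ)] {t : Set (centralLie E N)}

theorem exists_contMDiff_separating_times (ht : ∀ X ∈ t, centralExp X ∈ Γ) {T : Set ℝ}
    (hT : IsCompact T) {t₀ : ℝ}
    (ht₀ : ∀ s ∈ T, t₀ - s ∉ returnTimes Γ (Submodule.span ℝ t) w) (q : N ⧸ Γ) :
    ∃ φ : N ⧸ Γ → ℝ, ContMDiff 𝓘(ℝ, E) 𝓘(ℝ, ℝ) ∞ φ ∧ (∀ x, φ x ∈ Icc 0 1) ∧
      Submodule.span ℝ t ≤ invariantDirections φ ∧ (∀ s ∈ T, φ (centralExp (s • w) • q) = 0) ∧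
      φ (centralExp (t₀ • w) • q) = 1 := by
  have hcont : Continuous (fun s : ℝ ↦ centralExp (s • w) • q) :=
    continuous_centralExp_smul_smul continuous_id continuous_const w
  have hdisj : Disjoint
      (centralSaturation (Submodule.span ℝ t) ((fun s : ℝ ↦ centralExp (s • w) • q) '' T))
      (centralSaturation (Submodule.span ℝ t) {centralExp (t₀ • w) • q}) := by
    rw [Set.disjoint_left]
    rintro x ⟨Y, hY, _, ⟨s, hs, rfl⟩, hYx⟩ hx
    exact ht₀ s hs (sub_mem_returnTimes ⟨Y, hY, _, rfl, hYx⟩ hx)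
  obtain ⟨φ, hφ, h01, hinv, h0, h1⟩ :=
    exists_contMDiff_separating_saturations ht (hT.image hcont) isCompact_singleton hdisj
  exact ⟨φ, hφ, h01, hinv, fun s hs ↦ h0 (mem_image_of_mem _ hs), h1 rfl⟩

theorem exists_contMDiff_separating_orbit (ht : ∀ X ∈ t, centralExp X ∈ Γ)
    (hw : w ∉ Submodule.span ℝ t) {d : ℝ} (hd : 1 < |d|) (K : ℕ) (q : N ⧸ Γ) :
    ∃ (φ : N ⧸ Γ → ℝ) (t₀ : ℝ), ContMDiff 𝓘(ℝ, E) 𝓘(ℝ, ℝ) ∞ φ ∧ (∀ x, φ x ∈ Icc 0 1) ∧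
      Submodule.span ℝ t ≤ invariantDirections φ ∧ φ q = 0 ∧
      φ (centralExp (t₀ • w) • q) = 1 ∧
      (∀ k : ℕ, φ (centralExp (((d ^ (k + 1))⁻¹ * t₀) • w) • q) = 0) ∧
      ∀ k < K, φ (centralExp ((d ^ (k + 1) * t₀) • w) • q) = 0 := by
  obtain ⟨t₀, ht₀, ht₀_pow⟩ :=
    exists_notMem_countable_of_one_lt_abs (countable_returnTimes (Γ := Γ) hw) hd
  have hlim : Tendsto (fun k : ℕ ↦ (d ^ (k + 1))⁻¹ * t₀) atTop (𝓝 0) := by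
    have hd' : |d⁻¹| < 1 := by rw [abs_inv]; exact inv_lt_one_of_one_lt₀ hd
    have hpow := (tendsto_pow_atTop_nhds_zero_of_abs_lt_one hd').comp (tendsto_add_atTop_nat 1)
    simpa only [comp_def, inv_pow, zero_mul] using hpow.mul_const t₀
  obtain ⟨φ, hφ, h01, hinv, hzero, hone⟩ := exists_contMDiff_separating_times ht
    (hlim.isCompact_insert_range.union
      ((finite_Iio K).image fun k ↦ d ^ (k + 1) * t₀).isCompact) (t₀ := t₀) (w := w) (by
        rintro s ((rfl | ⟨k, rfl⟩) | ⟨k, -, rfl⟩)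
        · rwa [sub_zero]
        · simpa only [zpow_neg, ← Nat.cast_succ, zpow_natCast] using
            ht₀_pow (-(k + 1 : ℕ)) (by omega)
        · simpa only [← Nat.cast_succ, zpow_natCast] using ht₀_pow (k + 1 : ℕ) (by omega)) q
  refine ⟨φ, t₀, hφ, h01, hinv, ?_, hone, fun k ↦ hzero _ (Or.inl (Or.inr ⟨k, rfl⟩)),
    fun k hk ↦ hzero _ (Or.inr ⟨k, hk, rfl⟩)⟩
  simpa using hzero 0 (Or.inl (mem_insert _ _))

end Choice

/-! ## Failure of rigidity -/

section NotRigid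

open Module

theorem mem_span_preimage_coe_iff {R M : Type*} [Ring R] [AddCommGroup M] [Module R M]
    {P : Submodule R M} {s : Set M} (hs : s ⊆ P) {x : P} :
    x ∈ Submodule.span R ((↑) ⁻¹' s : Set P) ↔ (x : M) ∈ Submodule.span R s := by
  have hmap : (Submodule.span R ((↑) ⁻¹' s : Set P)).map P.subtype = Submodule.span R s := by
    rw [Submodule.map_span]
    exact congrArg _ (image_preimage_eq_of_subset (hs.trans Subtype.range_coe.ge))
  rw [← hmap]
  exact ⟨fun hx ↦ Submodule.mem_map_of_mem hx, fun ⟨_, hy, hyx⟩ ↦ Subtype.ext hyx ▸ hy⟩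

variable {E : Type*} [NormedAddCommGroup E] [NormedSpace ℝ E]
  {N : Type*} [TopologicalSpace N] [ChartedSpace E N] [Group N] {Γ : Subgroup N}

theorem LatticeAut.isFixedPt_one (L : LatticeAut E Γ) :
    IsFixedPt L.quotientEquiv ((1 : N) : N ⧸ Γ) := by
  rw [IsFixedPt, L.quotientEquiv_mk, map_one]

variable [LieGroup 𝓘(ℝ, E) ∞ N] {L : LatticeAut E Γ} {ι : Type*} {b : Basis ι ℝ E} {l : ι → ℝ}
  {i j : ι} {v w : centralLie E N}

theorem centralMap_eq_smul
    (hb : End.HasEigenvector (L.modelDifferential : E →ₗ[ℝ] E) (l i) (b i))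
    (hv : (v : E) = b i) : L.centralMap v = l i • v :=
  Subtype.ext ((congrArg L.modelDifferential hv).trans (hb.apply_eq_smul.trans (hv ▸ rfl)))

variable [FiniteDimensional ℝ E] [DiscreteTopology Γ]

theorem LatticeAut.exists_expanding_pair_mem_span_centralLattice (L : LatticeAut E Γ)
    (hAnosov : L.IsAnosov) (hSimple : L.HasSimpleSpectrum) (hReducible : L.IsReducibleOnCenter) :
    ∃ (ι : Type) (b : Basis ι ℝ E) (l : ι → ℝ) (i j : ι) (S : Submodule ℝ E),
      (∀ i, End.HasEigenvector (L.modelDifferential : E →ₗ[ℝ] E) (l i) (b i)) ∧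
      Injective (fun i ↦ |l i|) ∧ 1 < |l i| ∧ |l i| < |l j| ∧
      S ≤ Submodule.span ℝ ((S : Set E) ∩ centralLattice E Γ) ∧ b i ∈ S ∧
      b j ∈ Submodule.span ℝ (centralLattice E Γ : Set E) ∧ b j ∉ S := by
  have hnodup : (((L.modelDifferential : E →ₗ[ℝ] E).charpoly.aroots ℂ).map (‖·‖)).Nodup := hSimple
  obtain ⟨ι, _, b, l, hb, hl, hroot⟩ := exists_eigenbasis_of_nodup_norm _ hnodup
  have hl1 (i : ι) : |l i| ≠ 1 := by
    have hnorm : ‖(l i : ℂ)‖ ≠ 1 := hAnosov _ (hroot i)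
    rwa [Complex.norm_real] at hnorm
  obtain ⟨W, hW0, hWV, hLW⟩ := hReducible
  let : Module ℚ E := groupLieAlgebraRatModule (E := E) (N := N)
  have hWΛ : (show Submodule ℚ E from W) < Submodule.span ℚ (centralLattice E Γ : Set E) := by
    rw [coe_centralLattice]
    exact hWV
  obtain ⟨i, j, S, hpair⟩ := exists_expanding_pair hb L.modelDifferential_injective hl hl1
    (fun X hX ↦ L.modelDifferential_mem_centralLattice hX) (W := W) hW0 hWΛ hLW
  exact ⟨ι, b, l, i, j, S, hb, hl, hpair⟩

theorem LatticeAut.exists_expanding_central_pair (L : LatticeAut E Γ)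
    (hAnosov : L.IsAnosov) (hSimple : L.HasSimpleSpectrum) (hReducible : L.IsReducibleOnCenter) :
    ∃ (ι : Type) (b : Basis ι ℝ E) (l : ι → ℝ) (i j : ι) (v w : centralLie E N)
      (t : Set (centralLie E N)),
      (∀ i, End.HasEigenvector (L.modelDifferential : E →ₗ[ℝ] E) (l i) (b i)) ∧
      Injective (fun i ↦ |l i|) ∧ (v : E) = b i ∧ (w : E) = b j ∧ 1 < |l i| ∧ |l i| < |l j| ∧
      (∀ X ∈ t, centralExp X ∈ Γ) ∧ v ∈ Submodule.span ℝ t ∧ w ∉ Submodule.span ℝ t := by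
  obtain ⟨ι, b, l, i, j, S, hb, hl, hi, hij, hS, hiS, hjΛ, hjS⟩ :=
    L.exists_expanding_pair_mem_span_centralLattice hAnosov hSimple hReducible
  have hΛ : Submodule.span ℝ (centralLattice E Γ : Set E) ≤ centralLie E N :=
    Submodule.span_le.2 centralLattice_subset_centralLie
  have hSΛ : (S : Set E) ∩ centralLattice E Γ ⊆ centralLie E N :=
    inter_subset_right.trans centralLattice_subset_centralLie
  refine ⟨ι, b, l, i, j, ⟨b i, Submodule.span_le.2 hSΛ (hS hiS)⟩, ⟨b j, hΛ hjΛ⟩,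
    (↑) ⁻¹' ((S : Set E) ∩ centralLattice E Γ), hb, hl, rfl, rfl, hi, hij, ?_, ?_, ?_⟩
  · exact fun X hX ↦ coe_mem_centralLattice.1 hX.2
  · exact (mem_span_preimage_coe_iff hSΛ).2 (hS hiS)
  · rw [mem_span_preimage_coe_iff hSΛ]
    exact fun hj ↦ hjS (Submodule.span_le.2 inter_subset_left hj)

theorem tendsto_perturbDiffeo {c : ℝ} (hv : L.centralMap v = c • v) (hc : c ≠ 0)
    {φ : N ⧸ Γ → ℝ} (hvφ : ∀ ε : ℝ, v ∈ invariantDirections fun q ↦ ε * φ q)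
    (hφ : ∀ ε : ℝ, ContMDiff 𝓘(ℝ, E) 𝓘(ℝ, ℝ) ∞ fun q ↦ ε * φ q) :
    Tendsto (fun ε ↦ perturbDiffeo hv hc (hvφ ε) (hφ ε)) (𝓝 0)
      (@nhds _ (c1Topology (E := E) (M := N ⧸ Γ)) L.quotientDiffeo) := by
  have hzero : perturbDiffeo hv hc (hvφ 0) (hφ 0) = L.quotientDiffeo :=
    Diffeomorph.ext fun q ↦ by
      change centralExp (((0 : ℝ) * φ q) • v) • L.quotientEquiv q = L.quotientEquiv q
      simp
  rw [← hzero]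
  have hφ1 : ContMDiff 𝓘(ℝ, E) 𝓘(ℝ, ℝ) ∞ φ := by simpa only [one_mul] using hφ 1
  exact tendsto_c1Topology (contMDiff_centralExp_smul_smul le_rfl
    (contMDiff_fst.mul (hφ1.comp contMDiff_snd))
    ((contMDiff_quotientEquiv L).comp contMDiff_snd) v) 0

theorem not_locallyPeriodicDataRigid_of_not_hasModelDeriv_conjMap
    (hb : ∀ i, End.HasEigenvector (L.modelDifferential : E →ₗ[ℝ] E) (l i) (b i))
    (hl : Injective (fun i ↦ |l i|)) (hv : (v : E) = b i) (hi : 1 < |l i|) {φ : N ⧸ Γ → ℝ}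
    (hφ : ContMDiff 𝓘(ℝ, E) 𝓘(ℝ, ℝ) ∞ φ) {C : ℝ} (hC : ∀ q, |φ q| ≤ C)
    (hvφ : v ∈ invariantDirections φ)
    (hconj : ∀ ε ≠ 0, ∃ o, ∀ A : E →L[ℝ] E,
      ¬ HasModelDeriv (conjMap L v (l i) fun q ↦ ε * φ q) o A) :
    ¬ LocallyPeriodicDataRigid (E := E) L.quotientDiffeo := by
  rintro ⟨U, hU, hrigid⟩
  have hLv := centralMap_eq_smul (hb i) hv
  have hφε : ∀ ε : ℝ, ContMDiff 𝓘(ℝ, E) 𝓘(ℝ, ℝ) ∞ fun q ↦ ε * φ q :=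
    fun ε ↦ contMDiff_const.mul hφ
  have hvφε : ∀ ε : ℝ, v ∈ invariantDirections fun q ↦ ε * φ q :=
    fun ε t q ↦ congrArg (ε * ·) (hvφ t q)
  have hCε : ∀ (ε : ℝ) (q : N ⧸ Γ), |ε * φ q| ≤ |ε| * C := fun ε q ↦ by
    rw [abs_mul]
    exact mul_le_mul_of_nonneg_left (hC q) (abs_nonneg ε)
  have hlim := tendsto_perturbDiffeo hLv (abs_pos.1 (one_pos.trans hi)) hvφε hφε
  obtain ⟨ε, hεU, hε⟩ := (((hlim.eventually hU).filter_mono nhdsWithin_le_nhds).and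
    (self_mem_nhdsWithin (s := {(0 : ℝ)}ᶜ))).exists
  have hsemi := quotientEquiv_conjMap hLv (hvφε ε) hi (hCε ε)
  obtain ⟨o, ho⟩ := hconj ε hε
  have hC1 := hrigid _ hεU (isC1Plus_of_contMDiff (contMDiff_perturb (hφε ε)))
    (conjHomeo hLv (hvφε ε) hi (hCε ε) (hφε ε).continuous) hsemi
    (samePeriodicData_perturb hb hl hv (hvφε ε) (hφε ε) hsemi)
  exact ho _ (hasModelDeriv_of_contMDiffAt (hC1.1 o) one_ne_zero)

theorem not_locallyPeriodicDataRigid_of_expanding_pair [SigmaCompactSpace (N ⧸ Γ)]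
    (hb : ∀ i, End.HasEigenvector (L.modelDifferential : E →ₗ[ℝ] E) (l i) (b i))
    (hl : Injective (fun i ↦ |l i|)) (hv : (v : E) = b i) (hw : (w : E) = b j) (hi : 1 < |l i|)
    (hij : |l i| < |l j|) {t : Set (centralLie E N)} (ht : ∀ X ∈ t, centralExp X ∈ Γ)
    (hvt : v ∈ Submodule.span ℝ t) (hwt : w ∉ Submodule.span ℝ t) :
    ¬ LocallyPeriodicDataRigid (E := E) L.quotientDiffeo := by
  obtain ⟨K, hK⟩ := pow_unbounded_of_one_lt (|l i| - 1)⁻¹ hi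
  obtain ⟨φ, t₀, hφ, h01, htφ, hφo, hφ₁, hφ_neg, hφ_pos⟩ := exists_contMDiff_separating_orbit ht
    hwt (hi.trans hij) K ((1 : N) : N ⧸ Γ)
  have hC : ∀ q, |φ q| ≤ 1 := fun q ↦ abs_le.2 ⟨by linarith [(h01 q).1], (h01 q).2⟩
  have hLw := centralMap_eq_smul (hb j) hw
  have hv0 : v ≠ 0 := by
    rintro rfl
    exact b.ne_zero i hv.symm
  have hmax (q : N ⧸ Γ) : |φ q| ≤ |φ (centralExp (t₀ • w) • ((1 : N) : N ⧸ Γ))| := by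
    rw [hφ₁, abs_one]
    exact hC q
  have hu : transferFunction L.quotientEquiv (l i) φ
      (centralExp (t₀ • w) • ((1 : N) : N ⧸ Γ)) ≠ 0 :=
    transferFunction_ne_zero hi hK (hφ₁ ▸ one_ne_zero) hmax fun k hk ↦ by
      rw [← iterate_succ_apply, iterate_quotientEquiv_centralExp_smul hLw,
        (L.isFixedPt_one.iterate _).eq, hφ_pos k hk]
  refine not_locallyPeriodicDataRigid_of_not_hasModelDeriv_conjMap hb hl hv hi hφ hC (htφ hvt)
    fun ε hε ↦ ⟨((1 : N) : N ⧸ Γ), ?_⟩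
  have hCε (q : N ⧸ Γ) : |ε * φ q| ≤ |ε| := by
    rw [abs_mul]
    exact mul_le_of_le_one_right (abs_nonneg ε) (hC q)
  exact not_hasModelDeriv_conjMap (ψ := fun q ↦ ε * φ q) hLw hi hij hv0 hCε
    (continuous_const.mul hφ.continuous) L.isFixedPt_one (by simp only [hφo, mul_zero])
    (t₀ := t₀) (fun k ↦ by simp only [hφ_neg, mul_zero])
    (by rw [transferFunction_const_mul]; exact mul_ne_zero hε hu)

end NotRigid

end

theorem proposition8p2_general {E : Type*} [NormedAddCommGroup E] [NormedSpace ℝ E]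
    [FiniteDimensional ℝ E] {N : Type*} [TopologicalSpace N] [ChartedSpace E N] [Group N]
    [LieGroup 𝓘(ℝ, E) ∞ N] (Γ : Subgroup N) [DiscreteTopology Γ] [SigmaCompactSpace (N ⧸ Γ)]
    (L : LatticeAut E Γ) (hAnosov : L.IsAnosov) (hSimple : L.HasSimpleSpectrum)
    (hReducible : L.IsReducibleOnCenter) :
    ¬ LocallyPeriodicDataRigid (E := E) L.quotientDiffeo := by
  obtain ⟨ι, b, l, i, j, v, w, t, hb, hl, hv, hw, hi, hij, ht, hvt, hwt⟩ :=
    L.exists_expanding_central_pair hAnosov hSimple hReducible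
  exact not_locallyPeriodicDataRigid_of_expanding_pair hb hl hv hw hi hij ht hvt hwt

theorem proposition8p2 {E : Type*} [NormedAddCommGroup E] [NormedSpace ℝ E]
    [FiniteDimensional ℝ E]
    {N : Type*} [TopologicalSpace N] [T2Space N] [ConnectedSpace N] [ChartedSpace E N] [Group N]
    [LieGroup 𝓘(ℝ, E) ∞ N] [Group.IsNilpotent N]
    (Γ : Subgroup N) [DiscreteTopology Γ] [CompactSpace (N ⧸ Γ)]
    (L : LatticeAut E Γ) (hAnosov : L.IsAnosov) (hSimple : L.HasSimpleSpectrum)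
    (hReducible : L.IsReducibleOnCenter) :
    ¬ LocallyPeriodicDataRigid (E := E) L.quotientDiffeo :=
  proposition8p2_general Γ L hAnosov hSimple hReducible
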